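/- (Umlaufsatz.) Identify the oriented Euclidean plane with $\mathbb{C}$. Let $\gamma$ be a smooth regular plane curve on a parameter interval (smooth: all derivatives exist on the whole interval, one-sided at its ends; regular: $\gamma'\neq 0$), with unit tangent $T=\gamma'/|\gamma'|$ and left unit normal $N=iT$. Its signed curvature $k$ is defined by $dT/ds=k\,N$, where $s$ is arc length, $ds=|\gamma'|\,dt$, and its total signed curvature is $\Psi(\gamma)=\int k\,ds$ (over one period, for a closed smooth regular curve given by a periodic parametrization). Let a closed piecewise smooth regular curve $\gamma$ be the cyclic concatenation of smooth regular arcs $\gamma_1,\dots,\gamma_n$, $n\ge 1$. Let $\theta_i\in(-\pi,\pi]$ be the signed external angle at the end of $\gamma_i$, that is, the signed angle from the final velocity of $\gamma_i$ to the initial velocity of $\gamma_{i+1}$ (with $\gamma_{n+1}=\gamma_1$), positive for a left turn. The total signed curvature is $$\Psi(\gamma)=\Psi(\gamma_1)+\dots+\Psi(\gamma_n)+\theta_1+\dots+\theta_n ,$$ and it is said to be defined if $\gamma$ nowhere turns exactly backward, that is, if $\theta_i\neq\pi$ for all $i$. For a closed simple curve $\gamma$, the region bounded by $\gamma$ is the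 bounded part of the complement of its image. It lies on the left of $\gamma$ if for every parameter $t$ (other than the joints, in the piecewise smooth case) the point $\gamma(t)+\varepsilon\, i\,\gamma'(t)$ belongs to it for all sufficiently small $\varepsilon>0$. 1. If $\gamma$ is a closed simple smooth regular plane curve, then $\Psi(\gamma)=\pm 2\pi$; it is $+2\pi$ if the region bounded by $\gamma$ lies on the left of $\gamma$, and $-2\pi$ otherwise. 2. The same holds for every closed simple piecewise smooth regular plane curve $\gamma$ whose total signed curvature is defined. -/

import Mathlib

open scoped ContDiff

noncomputable section

namespace PlaneCurve

/-! The oriented Euclidean plane is `ℂ`; multiplication by `Complex.I` is the counterclockwise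
rotation by `π / 2`. A curve is a map `γ : ℝ → ℂ`, considered on a parameter interval `D`
(`D = Set.univ` for a periodic parametrization); derivatives at the ends of `D` are one-sided. -/

/-- The velocity vector of `γ : D → ℂ`. -/
def velocity (γ : ℝ → ℂ) (D : Set ℝ) (t : ℝ) : ℂ := derivWithin γ D t

/-- The unit tangent vector `T`. -/
def unitTangent (γ : ℝ → ℂ) (D : Set ℝ) (t : ℝ) : ℂ :=
  (‖velocity γ D t‖⁻¹ : ℝ) • velocity γ D t

/-- The unit normal vector `N`: the tangent rotated counterclockwise by `π / 2`. -/
def unitNormal (γ : ℝ → ℂ) (D : Set ℝ) (t : ℝ) : ℂ := Complex.I * unitTangent γ D t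

/-- The signed curvature of a regular curve: the coefficient `k` in `dT/ds = k N`, where
`d/ds = ‖γ'‖⁻¹ d/dt` is the derivative with respect to arc length. -/
def signedCurvature (γ : ℝ → ℂ) (D : Set ℝ) (t : ℝ) : ℝ :=
  inner ℝ ((‖velocity γ D t‖⁻¹ : ℝ) • derivWithin (unitTangent γ D) D t) (unitNormal γ D t)

/-- The integral of the signed curvature with respect to arc length `ds = ‖γ'‖ dt` over the
parameters from `a` to `b`. -/
def curvatureIntegral (γ : ℝ → ℂ) (D : Set ℝ) (a b : ℝ) : ℝ :=
  ∫ t in a..b, signedCurvature γ D t * ‖velocity γ D t‖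

/-- The signed angle from `v` to `w`, in `(-π, π]`, positive if `w` points to the left of `v`;
it equals `π` exactly when the nonzero vectors `v` and `w` have opposite directions. -/
def signedAngle (v w : ℂ) : ℝ := Complex.arg (w / v)

/-- The part of the plane enclosed by `K`: the union of the bounded connected components of the
complement of `K` (for a closed simple curve there is exactly one). -/
def boundedRegion (K : Set ℂ) : Set ℂ :=
  {p | p ∈ Kᶜ ∧ Bornology.IsBounded (connectedComponentIn Kᶜ p)}

/-- The set `F` lies on the left of `γ` at the parameters `S`: moving a little from `γ t`
along the left normal direction, one gets into `F`. -/
def LiesOnLeft (F : Set ℂ) (γ : ℝ → ℂ) (S : Set ℝ) : Prop :=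
  ∀ t ∈ S, ∀ᶠ ε in nhdsWithin (0 : ℝ) (Set.Ioi 0), γ t + ε • (Complex.I * deriv γ t) ∈ F

/-- `γ` is an `ℓ`-periodic parametrization of a closed simple smooth regular plane curve. -/
structure IsClosedSimpleSmoothRegular (γ : ℝ → ℂ) (ℓ : ℝ) : Prop where
  period_pos : 0 < ℓ
  periodic : Function.Periodic γ ℓ
  smooth : ContDiff ℝ ∞ γ
  regular : ∀ t, velocity γ Set.univ t ≠ 0
  simple : Set.InjOn γ (Set.Ico 0 ℓ)

/-- The total signed curvature of an `ℓ`-periodic smooth regular plane curve. -/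
def totalSignedCurvature (γ : ℝ → ℂ) (ℓ : ℝ) : ℝ := curvatureIntegral γ Set.univ 0 ℓ

/-- The parameter interval of the `i`-th arc for the subdivision `τ 0 < τ 1 < ... < τ n`. -/
def arcDomain {n : ℕ} (τ : Fin (n + 1) → ℝ) (i : Fin n) : Set ℝ :=
  Set.Icc (τ i.castSucc) (τ i.succ)

/-- `γ`, restricted to `[τ 0, τ n]`, is a closed simple plane curve that is the cyclic
concatenation of the `n` smooth regular arcs `γ|[τ i, τ (i + 1)]`. -/
structure IsClosedSimplePiecewiseSmoothRegular {n : ℕ} (γ : ℝ → ℂ) (τ : Fin (n + 1) → ℝ) :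
    Prop where
  pos : 0 < n
  strictMono : StrictMono τ
  smooth : ∀ i, ContDiffOn ℝ ∞ γ (arcDomain τ i)
  regular : ∀ i, ∀ t ∈ arcDomain τ i, velocity γ (arcDomain τ i) t ≠ 0
  closed : γ (τ 0) = γ (τ (Fin.last n))
  simple : Set.InjOn γ (Set.Ico (τ 0) (τ (Fin.last n)))

/-- The signed external angle at the joint between the `i`-th arc and the next one, in cyclic
order: the arc after the last one is the first one. -/
def externalAngle {n : ℕ} (γ : ℝ → ℂ) (τ : Fin (n + 1) → ℝ) (i : Fin n) : ℝ :=
  signedAngle (velocity γ (arcDomain τ i) (τ i.succ))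
    (velocity γ (arcDomain τ (finRotate n i)) (τ (finRotate n i).castSucc))

/-- The total signed curvature is defined if there are no cusps: at no joint does the curve turn
exactly backward. -/
def TotalSignedCurvatureDefined {n : ℕ} (γ : ℝ → ℂ) (τ : Fin (n + 1) → ℝ) : Prop :=
  ∀ i, externalAngle γ τ i ≠ Real.pi

/-- The total signed curvature of a closed piecewise smooth regular curve: the sum of the total
signed curvatures of its arcs and of the signed external angles at all its joints. -/
def piecewiseTotalSignedCurvature {n : ℕ} (γ : ℝ → ℂ) (τ : Fin (n + 1) → ℝ) : ℝ :=
  ∑ i, curvatureIntegral γ (arcDomain τ i) (τ i.castSucc) (τ i.succ) + ∑ i, externalAngle γ τ i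

end PlaneCurve

end

/-! This is Hopf's secant argument. Let `ℓ` be the period. The secant `γ t - γ s` does not vanish on
the convex set `s < t < s + ℓ`, so it has a continuous argument `φ` there. The exchange `(s, t) ↦
(t, s + ℓ)` reverses the secant, hence changes `φ` by a constant `B`; two exchanges translate both
parameters by a period.

Near the diagonal the secant direction tends to the tangent direction. Along each arc `φ` therefore
extends to the diagonal, where its change is the total curvature of the arc
(`IsArcLog.curvatureIntegral_eq`). At a joint the two one-sided limits differ by the external angle
(`IsArcLog.joint`), because without a cusp the secants across the joint stay in a half plane. Over
one period these changes add up to `2 * B` (`sum_arcLog_eq`).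

It remains to see that `B = ±π`. The angle swept by the curve about a point slightly to the left of
a smooth point is `B + π`, and slightly to the right it is `B - π`. This angle is `0` about every
point of an unbounded component of the complement, and at some smooth point one of the two sides
lies in such a component (`IsLoop.exists_side_unbounded`). If it is the right side, then `B = π`,
and every left side has angle `2π`, so it is bounded; if it is the left side, then `B = -π`. The
Jordan curve theorem is not needed. -/

namespace PlaneCurve

open Set Filter Topology

/-! ### Continuous logarithms and comparison of arguments -/

/-- A nonvanishing continuous function on a convex set has a continuous logarithm. -/
theorem exists_continuousOn_log {E : Type*} [NormedAddCommGroup E] [NormedSpace ℝ E] {S : Set E}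
    (hS : Convex ℝ S) {f : E → ℂ} (hf : ContinuousOn f S) (h0 : ∀ x ∈ S, f x ≠ 0) :
    ∃ L : E → ℂ, ContinuousOn L S ∧ ∀ x ∈ S, Complex.exp (L x) = f x := by
  classical
  rcases S.eq_empty_or_nonempty with rfl | ⟨x₀, hx₀⟩
  · exact ⟨0, continuousOn_empty _, by simp⟩
  -- Convexity supplies the simple connectedness and local path connectedness needed to lift `f`
  -- through the covering `exp` of the punctured plane.
  have := hS.contractibleSpace ⟨x₀, hx₀⟩
  have := hS.locallyPathConnectedSpace
  rcases Complex.isCoveringMapOn_exp.existsUnique_continuousMap_lifts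
    (a₀ := (⟨x₀, hx₀⟩ : S)) (e₀ := Complex.log (f x₀))
    ⟨S.domRestrict f, continuousOn_iff_continuous_domRestrict.mp hf⟩
    (Complex.exp_log (h0 x₀ hx₀)) (fun x ↦ h0 x x.2) with ⟨F, ⟨-, hF⟩, -⟩
  refine ⟨fun z ↦ if hz : z ∈ S then F ⟨z, hz⟩ else 0, ?_, fun x hx ↦ ?_⟩
  · rw [continuousOn_iff_continuous_domRestrict]
    convert! map_continuous F
    ext z
    simp [domRestrict]
  · simpa [hx, domRestrict] using congrFun hF ⟨x, hx⟩

/-- Two continuous logarithms whose exponentials have a constant quotient up to positive factors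
have imaginary parts that differ by a constant. -/
theorem im_sub_im_const {X : Type*} [TopologicalSpace X] {S : Set X} (hS : IsPreconnected S)
    {L M : X → ℂ} (hL : ContinuousOn L S) (hM : ContinuousOn M S) {c : ℂ} {r : X → ℝ}
    (hr : ∀ x ∈ S, 0 < r x)
    (h : ∀ x ∈ S, Complex.exp (L x) = r x * c * Complex.exp (M x)) {x y : X} (hx : x ∈ S)
    (hy : y ∈ S) : (L x).im - (M x).im = (L y).im - (M y).im := by
  set g : X → ℝ := fun x ↦ (L x).im - (M x).im with hg
  have hgc : ContinuousOn g S :=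
    (Complex.continuous_im.comp_continuousOn hL).sub (Complex.continuous_im.comp_continuousOn hM)
  -- The exponentials at `u` and `v` have a positive quotient after division by those of `M`, which
  -- excludes a rise of `g` in `(0, π]`. A rise of exactly `π` falls outside the range of the
  -- principal logarithm and is excluded by `cos (-π) = -1`.
  have key : ∀ u ∈ S, ∀ v ∈ S, g u < g v → g v ≤ g u + Real.pi → False := by
    intro u hu v hv h1 h2
    have hc : c ≠ 0 := by
      rintro rfl
      simpa using h u hu
    have e1 : Complex.exp (L u - M u - (L v - M v)) = (r u / r v : ℝ) := by
      have := hr v hv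
      rw [Complex.exp_sub, Complex.exp_sub, Complex.exp_sub, h u hu, h v hv]
      have h3 := Complex.exp_ne_zero (M u)
      have h4 := Complex.exp_ne_zero (M v)
      have h5 : (r v : ℂ) ≠ 0 := by exact_mod_cast this.ne'
      push_cast
      field_simp
    have e2 := congrArg Complex.arg e1
    rw [Complex.arg_ofReal_of_nonneg (div_pos (hr u hu) (hr v hv)).le, ← Complex.log_im] at e2
    have him : (L u - M u - (L v - M v)).im = g u - g v := by simp [hg]
    rcases h2.lt_or_eq with h2 | h2
    · rw [Complex.log_exp (by rw [him]; linarith) (by rw [him]; linarith [Real.pi_pos]), him] at e2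
      linarith
    · have e3 := congrArg Complex.re e1
      rw [Complex.exp_re, him, Complex.ofReal_re, h2] at e3
      have : Real.cos (g u - (g u + Real.pi)) = -1 := by simp
      rw [this] at e3
      have := div_pos (hr u hu) (hr v hv)
      have := Real.exp_pos (L u - M u - (L v - M v)).re
      linarith
  -- By connectedness, any rise of `g` contains a rise of height at most `π`.
  have key2 : ∀ u ∈ S, ∀ v ∈ S, ¬ g u < g v := by
    intro u hu v hv h1
    have hI := (hS.image g hgc).Icc_subset (mem_image_of_mem g hu) (mem_image_of_mem g hv)
    obtain ⟨w, hw, hwe⟩ := hI (show min (g v) (g u + Real.pi) ∈ Icc (g u) (g v) from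
      ⟨le_min h1.le (by linarith [Real.pi_pos]), min_le_left _ _⟩)
    refine key u hu w hw ?_ ?_
    · rw [hwe]; exact lt_min h1 (by linarith [Real.pi_pos])
    · rw [hwe]; exact min_le_right _ _
  exact le_antisymm (not_lt.1 (key2 y hy x hx)) (not_lt.1 (key2 x hx y hy))

/-- On a set where `exp ∘ L` stays in an open half plane, the imaginary part of `L` is the argument
up to a constant. -/
theorem im_sub_arg_const {X : Type*} [TopologicalSpace X] {S : Set X} (hS : IsPreconnected S)
    {L f : X → ℂ} (hL : ContinuousOn L S) {c : ℂ} (hf : ContinuousOn f S)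
    (hpos : ∀ x ∈ S, 0 < (f x).re)
    (h : ∀ x ∈ S, ∃ r : ℝ, 0 < r ∧ Complex.exp (L x) = r * c * f x) {x y : X} (hx : x ∈ S)
    (hy : y ∈ S) : (L x).im - (f x).arg = (L y).im - (f y).arg := by
  choose! r hr h using h
  have := im_sub_im_const hS hL (M := fun x ↦ Complex.log (f x))
    (hf.clog fun x hx ↦ Or.inl (hpos x hx)) (c := c) hr (fun x hx ↦ by
      rw [h x hx, Complex.exp_log]
      intro h0
      have := hpos x hx
      rw [h0] at this
      simp at this) hx hy
  simpa [Complex.log_im] using this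

/-! ### The argument of the secant -/

/-- A closed simple curve, given by a periodic parametrization. -/
structure IsLoop (γ : ℝ → ℂ) (ℓ : ℝ) : Prop where
  pos : 0 < ℓ
  periodic : Function.Periodic γ ℓ
  continuous : Continuous γ
  ne : ∀ s t, s < t → t < s + ℓ → γ s ≠ γ t

/-- The pairs of parameters that differ by less than a period. -/
def strip (ℓ : ℝ) : Set (ℝ × ℝ) := {x | x.1 < x.2 ∧ x.2 < x.1 + ℓ}

theorem convex_strip (ℓ : ℝ) : Convex ℝ (strip ℓ) := by
  rintro ⟨s, t⟩ ⟨h1, h2⟩ ⟨s', t'⟩ ⟨h3, h4⟩ a b ha hb hab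
  simp only [strip, mem_ofPred_eq, Prod.smul_mk, Prod.mk_add_mk, smul_eq_mul] at *
  obtain rfl : b = 1 - a := by linarith
  rcases ha.eq_or_lt with rfl | ha
  · constructor <;> nlinarith
  · constructor <;> nlinarith [mul_pos ha (sub_pos.2 h1), mul_pos ha (sub_pos.2 h2)]

/-- `L` is a continuous logarithm of the secant `γ t - γ s`, and `B` is the change of its argument
when the two end points are exchanged. -/
structure IsSecantLog (γ : ℝ → ℂ) (ℓ : ℝ) (L : ℝ × ℝ → ℂ) (B : ℝ) : Prop where
  continuousOn : ContinuousOn L (strip ℓ)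
  exp_eq : ∀ s t, s < t → t < s + ℓ → Complex.exp (L (s, t)) = γ t - γ s
  exchange : ∀ s t, s < t → t < s + ℓ → (L (t, s + ℓ)).im = (L (s, t)).im + B

/-- The exchange of end points preserves the strip and multiplies the secant by `-1`, so the change
of the argument is constant on the connected strip; its value is read off at `(0, ℓ / 2)`. -/
theorem IsLoop.exists_isSecantLog {γ : ℝ → ℂ} {ℓ : ℝ} (h : IsLoop γ ℓ) :
    ∃ L B, IsSecantLog γ ℓ L B := by
  have hc := h.continuous
  obtain ⟨L, hL, hexp⟩ := exists_continuousOn_log (convex_strip ℓ)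
    (f := fun x ↦ γ x.2 - γ x.1) (by fun_prop)
    (fun x hx ↦ sub_ne_zero.2 (h.ne _ _ hx.1 hx.2).symm)
  have hm : MapsTo (fun x : ℝ × ℝ ↦ (x.2, x.1 + ℓ)) (strip ℓ) (strip ℓ) := fun x hx ↦
    ⟨hx.2, by simpa using hx.1⟩
  have hp := h.pos
  have h0 : ((0 : ℝ), ℓ / 2) ∈ strip ℓ := ⟨by simpa using hp, by simpa using hp⟩
  refine ⟨L, (L (ℓ / 2, 0 + ℓ)).im - (L (0, ℓ / 2)).im, hL, fun s t h1 h2 ↦ hexp (s, t) ⟨h1, h2⟩,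
    fun s t h1 h2 ↦ ?_⟩
  have := im_sub_im_const (convex_strip ℓ).isPreconnected
    (L := fun x ↦ L (x.2, x.1 + ℓ)) (M := L) (hL.comp (by fun_prop) hm) hL
    (c := -1) (r := fun _ ↦ 1) (fun _ _ ↦ one_pos) (fun x hx ↦ by
      rw [hexp _ (hm hx), hexp x hx]
      simp [h.periodic x.1])
    (show (s, t) ∈ strip ℓ from ⟨h1, h2⟩) h0
  simp only at this
  linarith

theorem IsSecantLog.shift {γ : ℝ → ℂ} {ℓ B : ℝ} {L : ℝ × ℝ → ℂ} (h : IsSecantLog γ ℓ L B)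
    {s t : ℝ} (h1 : s < t) (h2 : t < s + ℓ) :
    (L (s + ℓ, t + ℓ)).im = (L (s, t)).im + 2 * B := by
  rw [h.exchange t (s + ℓ) h2 (by linarith), h.exchange s t h1 h2]
  ring

/-! ### Extension of the secant direction to the diagonal -/

/-- `h` is a continuous and nonvanishing extension of the difference quotient of `γ` on `[a, b]`
to the diagonal. -/
structure IsArc (γ : ℝ → ℂ) (a b : ℝ) (h : ℝ × ℝ → ℂ) : Prop where
  lt : a < b
  continuous : Continuous h
  secant : ∀ s ∈ Icc a b, ∀ t ∈ Icc a b, γ t - γ s = ((t - s : ℝ) : ℂ) * h (s, t)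
  ne : ∀ t ∈ Icc a b, h (t, t) ≠ 0

/-- The mean value of the velocity is a continuous difference quotient. -/
theorem exists_isArc {γ : ℝ → ℂ} {a b : ℝ} (hab : a < b) (hγ : ContDiffOn ℝ 1 γ (Icc a b))
    (hreg : ∀ t ∈ Icc a b, velocity γ (Icc a b) t ≠ 0) :
    ∃ h, IsArc γ a b h ∧ ∀ t ∈ Icc a b, h (t, t) = velocity γ (Icc a b) t := by
  have hVc : ContinuousOn (derivWithin γ (Icc a b)) (Icc a b) :=
    hγ.continuousOn_derivWithin (uniqueDiffOn_Icc hab) le_rfl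
  -- The extension by the end values makes the mean value of `V` continuous on the whole parameter
  -- plane.
  set V : ℝ → ℂ := IccExtend hab.le ((Icc a b).domRestrict (derivWithin γ (Icc a b))) with hV
  have hVcont : Continuous V := (continuousOn_iff_continuous_domRestrict.1 hVc).Icc_extend'
  have hVeq : ∀ t ∈ Icc a b, V t = derivWithin γ (Icc a b) t := fun t ht ↦ by
    rw [hV, IccExtend_of_mem _ _ ht]; rfl
  refine ⟨fun x ↦ ∫ u in (0 : ℝ)..1, V (x.1 + u * (x.2 - x.1)), ⟨hab, ?_, ?_, ?_⟩, ?_⟩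
  · exact intervalIntegral.continuous_parametric_intervalIntegral_of_continuous'
      (f := fun (x : ℝ × ℝ) u ↦ V (x.1 + u * (x.2 - x.1))) (by fun_prop) 0 1
  · intro s hs t ht
    have hderiv : ∀ x ∈ Icc a b, HasDerivWithinAt γ (V x) (Icc a b) x := fun x hx ↦ by
      rw [hVeq x hx]
      exact (hγ.differentiableOn one_ne_zero x hx).hasDerivWithinAt
    have hsub : uIcc s t ⊆ Icc a b := ordConnected_Icc.uIcc_subset hs ht
    have h1 : ∫ u in s..t, V u = γ t - γ s :=
      intervalIntegral.integral_eq_sub_of_hasDeriv_right (hγ.continuousOn.mono hsub)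
        (fun x hx ↦ by
          have hx' : x ∈ Ioo a b := by
            have h1 := hsub ⟨le_rfl, (inf_le_sup : s ⊓ t ≤ s ⊔ t)⟩
            have h2 := hsub ⟨(inf_le_sup : s ⊓ t ≤ s ⊔ t), le_rfl⟩
            exact ⟨h1.1.trans_lt hx.1, hx.2.trans_le h2.2⟩
          exact ((hderiv x ⟨hx'.1.le, hx'.2.le⟩).hasDerivAt
            (Icc_mem_nhds hx'.1 hx'.2)).hasDerivWithinAt)
        (hVcont.intervalIntegrable s t)
    rw [← h1]
    have := intervalIntegral.smul_integral_comp_add_mul (a := 0) (b := 1) V (t - s) s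
    simp only [mul_zero, add_zero, mul_one, add_sub_cancel, Complex.real_smul] at this
    rw [← this]
    simp only [mul_comm]
  · intro t ht
    simpa [hVeq t ht, velocity] using hreg t ht
  · intro t ht
    simpa [velocity] using hVeq t ht

/-- The ordered pairs of parameters in `[a, b]`. -/
def triangle (ℓ a b : ℝ) : Set (ℝ × ℝ) := {x | a ≤ x.1 ∧ x.1 ≤ x.2 ∧ x.2 ≤ b ∧ x.2 < x.1 + ℓ}

/-- A logarithm of a continuous difference quotient, on the closed triangle, whose argument agrees
with that of the secant. -/
structure IsArcLog (ℓ : ℝ) (L : ℝ × ℝ → ℂ) (a b : ℝ) (h Q : ℝ × ℝ → ℂ) : Prop where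
  continuousOn : ContinuousOn Q (triangle ℓ a b)
  im_eq : ∀ s t, a ≤ s → s < t → t ≤ b → t < s + ℓ → (Q (s, t)).im = (L (s, t)).im
  exp_eq : ∃ c, c ≠ 0 ∧ ∀ x ∈ triangle ℓ a b, Complex.exp (Q x) = c * h x

theorem convex_triangle (ℓ a b : ℝ) : Convex ℝ (triangle ℓ a b) := by
  rintro ⟨s, t⟩ ⟨h1, h2, h3, h4⟩ ⟨s', t'⟩ ⟨h5, h6, h7, h8⟩ p q hp hq hpq
  simp only [triangle, mem_ofPred_eq, Prod.smul_mk, Prod.mk_add_mk, smul_eq_mul] at *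
  obtain rfl : q = 1 - p := by linarith
  refine ⟨by nlinarith, by nlinarith, by nlinarith, ?_⟩
  rcases hp.eq_or_lt with rfl | hp
  · nlinarith
  · nlinarith [mul_pos hp (sub_pos.2 h4)]

theorem convex_triangle_inter (ℓ a b : ℝ) : Convex ℝ (triangle ℓ a b ∩ strip ℓ) :=
  (convex_triangle ℓ a b).inter (convex_strip ℓ)

variable {γ : ℝ → ℂ} {ℓ B : ℝ} {L : ℝ × ℝ → ℂ}

/-- On the triangle `h` has no zero: off the diagonal because the loop is simple, on it because the
arc is regular. Off the diagonal the secant is a positive multiple of `h`, so the arguments differ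
by a constant `k`, which is then subtracted. -/
theorem IsArc.exists_isArcLog (hγ : IsLoop γ ℓ) (hL : IsSecantLog γ ℓ L B) {a b : ℝ}
    {h : ℝ × ℝ → ℂ} (ha : IsArc γ a b h) : ∃ Q, IsArcLog ℓ L a b h Q := by
  have hne : ∀ x ∈ triangle ℓ a b, h x ≠ 0 := by
    rintro ⟨s, t⟩ ⟨h1, h2, h3, h4⟩ h0
    rcases h2.eq_or_lt with h5 | h5
    · simp only at h5
      subst h5
      exact ha.ne _ ⟨h1, h3⟩ h0
    · have := ha.secant s ⟨h1, h2.trans h3⟩ t ⟨h1.trans h2, h3⟩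
      rw [h0, mul_zero, sub_eq_zero] at this
      exact hγ.ne s t h5 h4 this.symm
  obtain ⟨Q, hQ, hexp⟩ := exists_continuousOn_log (convex_triangle ℓ a b)
    ha.continuous.continuousOn hne
  have hp := hγ.pos
  have hlt := ha.lt
  -- The arc may fill a whole period, so the base point must stay below `a + ℓ` as well as in `[a,
  -- b]`.
  have hx0 : (a, min b (a + ℓ / 2)) ∈ triangle ℓ a b ∩ strip ℓ := by
    have h1 : a < min b (a + ℓ / 2) := lt_min hlt (by linarith)
    have h2 : min b (a + ℓ / 2) < a + ℓ := (min_le_right _ _).trans_lt (by linarith)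
    exact ⟨⟨le_rfl, h1.le, min_le_left _ _, h2⟩, h1, h2⟩
  set x0 := (a, min b (a + ℓ / 2))
  set k : ℝ := (Q x0).im - (L x0).im with hk
  refine ⟨fun x ↦ Q x - k * Complex.I, hQ.sub continuousOn_const, ?_,
    Complex.exp (-(k * Complex.I)), Complex.exp_ne_zero _, fun x hx ↦ ?_⟩
  · intro s t h1 h2 h3 h4
    have hmem : (s, t) ∈ triangle ℓ a b ∩ strip ℓ := ⟨⟨h1, h2.le, h3, h4⟩, h2, h4⟩
    have := im_sub_im_const (convex_triangle_inter ℓ a b).isPreconnected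
      (L := L) (M := Q) (hL.continuousOn.mono inter_subset_right) (hQ.mono inter_subset_left)
      (c := 1) (r := fun x ↦ x.2 - x.1) (fun x hx ↦ sub_pos.2 hx.2.1) (fun x hx ↦ by
        obtain ⟨⟨g1, g2, g3, g4⟩, g5, g6⟩ := hx
        rw [hexp x ⟨g1, g2, g3, g4⟩, mul_one,
          ← ha.secant x.1 ⟨g1, g2.trans g3⟩ x.2 ⟨g1.trans g2, g3⟩]
        exact hL.exp_eq _ _ g5 g6) hmem hx0
    simp
    linarith
  · rw [sub_eq_add_neg, Complex.exp_add, hexp x hx, mul_comm]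

/-! ### The external angle at a joint -/

/-- Across a joint, the argument of the secant changes by the external angle. -/
theorem IsArcLog.joint (hℓ : 0 < ℓ) (hL : IsSecantLog γ ℓ L B) {a τ b : ℝ} {h₁ h₂ Q₁ Q₂ : ℝ × ℝ → ℂ}
    (ha₁ : IsArc γ a τ h₁) (ha₂ : IsArc γ τ b h₂) (hQ₁ : IsArcLog ℓ L a τ h₁ Q₁)
    (hQ₂ : IsArcLog ℓ L τ b h₂ Q₂) (hθ : Complex.arg (h₂ (τ, τ) / h₁ (τ, τ)) ≠ Real.pi) :
    (Q₂ (τ, τ)).im - (Q₁ (τ, τ)).im = Complex.arg (h₂ (τ, τ) / h₁ (τ, τ)) := by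
  have hlt₁ := ha₁.lt
  have hlt₂ := ha₂.lt
  set v := h₁ (τ, τ) with hv
  set r := h₂ (τ, τ) / v with hr
  set α := Complex.arg r with hα
  have hv0 : v ≠ 0 := ha₁.ne τ ⟨hlt₁.le, le_rfl⟩
  have hr0 : r ≠ 0 := div_ne_zero (ha₂.ne τ ⟨le_rfl, hlt₂.le⟩) hv0
  have hα1 : -Real.pi < α := Complex.neg_pi_lt_arg r
  have hα2 : α < Real.pi := lt_of_le_of_ne (Complex.arg_le_pi r) hθ
  have hcos : 0 < Real.cos (α / 2) := Real.cos_pos_of_mem_Ioo ⟨by linarith, by linarith⟩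
  -- `v * m` is the bisector of the two tangent directions at the joint. Relative to it they have
  -- arguments `-α / 2` and `α / 2`; both lie in the right half plane exactly because there is no
  -- cusp.
  set m := Complex.exp ((α / 2 : ℝ) * Complex.I) with hm
  have hm0 : m ≠ 0 := Complex.exp_ne_zero _
  have hw0 : v * m ≠ 0 := mul_ne_zero hv0 hm0
  set P₁ : ℝ → ℂ := fun u ↦ h₁ (τ - u, τ) / (v * m) with hP₁
  set P₂ : ℝ → ℂ := fun u ↦ h₂ (τ, τ + u) / (v * m) with hP₂
  have hc₁ : Continuous P₁ := by
    have := ha₁.continuous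
    fun_prop
  have hc₂ : Continuous P₂ := by
    have := ha₂.continuous
    fun_prop
  have e₁ : P₁ 0 = Complex.exp ((-(α / 2) : ℝ) * Complex.I) := by
    simp only [hP₁, sub_zero, ← hv]
    rw [Complex.ofReal_neg, neg_mul, Complex.exp_neg, ← hm]
    field_simp
  have e₂ : P₂ 0 = (‖r‖ : ℝ) * Complex.exp ((α / 2 : ℝ) * Complex.I) := by
    have h1 : h₂ (τ, τ) = v * r := by rw [hr]; field_simp
    have h2 : r = (‖r‖ : ℝ) * (m * m) := by
      conv_lhs => rw [← Complex.norm_mul_exp_arg_mul_I r]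
      rw [← Complex.exp_add]
      congr 2
      push_cast
      ring
    simp only [hP₂, add_zero, h1, ← hm]
    conv_lhs => rw [h2]
    field_simp
  have a₁ : (P₁ 0).arg = -(α / 2) := by
    rw [e₁, Complex.arg_exp_mul_I, toIocMod_eq_self]
    constructor <;> linarith
  have a₂ : (P₂ 0).arg = α / 2 := by
    rw [e₂, Complex.arg_real_mul _ (norm_pos_iff.2 hr0), Complex.arg_exp_mul_I, toIocMod_eq_self]
    constructor <;> linarith
  have p₁ : 0 < (P₁ 0).re := by
    rw [e₁, Complex.exp_ofReal_mul_I_re, Real.cos_neg]; exact hcos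
  have p₂ : 0 < (P₂ 0).re := by
    rw [e₂, Complex.re_ofReal_mul, Complex.exp_ofReal_mul_I_re]
    exact mul_pos (norm_pos_iff.2 hr0) hcos
  have ev : ∀ᶠ u in 𝓝 (0 : ℝ), 0 < (P₁ u).re ∧ 0 < (P₂ u).re ∧ u < τ - a ∧ u < b - τ ∧ u < ℓ / 2 :=
    ((Complex.continuous_re.comp hc₁).continuousAt.eventually_const_lt p₁).and <|
    ((Complex.continuous_re.comp hc₂).continuousAt.eventually_const_lt p₂).and <|
    (eventually_lt_nhds (by linarith)).and <| (eventually_lt_nhds (by linarith)).and <|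
    (eventually_lt_nhds (by linarith))
  obtain ⟨ε, hε, hball⟩ := Metric.eventually_nhds_iff_ball.1 ev
  set δ := ε / 2 with hδ
  have hδ0 : 0 < δ := by positivity
  have hP : ∀ u, 0 ≤ u → u ≤ δ →
      0 < (P₁ u).re ∧ 0 < (P₂ u).re ∧ u < τ - a ∧ u < b - τ ∧ u < ℓ / 2 := fun u h1 h2 ↦
    hball u (by rw [Real.ball_eq_Ioo]; constructor <;> linarith)
  obtain ⟨-, -, hδa, hδb, hδℓ⟩ := hP δ hδ0.le le_rfl
  -- A point of `S` stands for the secant from `τ - x.1` to `τ + x.2`. Divided by `v * m` it is `f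
  -- x`, a combination of `P₁` and `P₂` with nonnegative coefficients, not both zero, so it stays in
  -- the right half plane. Its argument can thus be compared at `(u, 0)` and `(0, u)`.
  set S : Set (ℝ × ℝ) := {x | 0 ≤ x.1 ∧ x.1 ≤ δ ∧ 0 ≤ x.2 ∧ x.2 ≤ δ ∧ 0 < x.1 + x.2} with hS
  have hSconv : Convex ℝ S := by
    rintro ⟨s, t⟩ ⟨h1, h2, h3, h4, h5⟩ ⟨s', t'⟩ ⟨g1, g2, g3, g4, g5⟩ p q hp hq hpq
    simp only [hS, mem_ofPred_eq, Prod.smul_mk, Prod.mk_add_mk, smul_eq_mul] at *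
    obtain rfl : q = 1 - p := by linarith
    refine ⟨by nlinarith, by nlinarith, by nlinarith, by nlinarith, ?_⟩
    rcases hp.eq_or_lt with rfl | hp
    · nlinarith
    · nlinarith [mul_pos hp h5]
  set f : ℝ × ℝ → ℂ := fun x ↦ (x.1 : ℂ) * P₁ x.1 + (x.2 : ℂ) * P₂ x.2 with hf
  have hmaps : MapsTo (fun x : ℝ × ℝ ↦ (τ - x.1, τ + x.2)) S (strip ℓ) := fun x hx ↦ by
    obtain ⟨h1, h2, h3, h4, h5⟩ := hx
    constructor <;> simp only <;> linarith
  have hconst : ∀ u, 0 < u → u ≤ δ →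
      (L (τ - u, τ)).im - (P₁ u).arg = (L (τ, τ + u)).im - (P₂ u).arg := by
    intro u hu hu'
    have h1 : (u, (0 : ℝ)) ∈ S := ⟨hu.le, hu', le_rfl, hδ0.le, by simpa using hu⟩
    have h2 : ((0 : ℝ), u) ∈ S := ⟨le_rfl, hδ0.le, hu.le, hu', by simpa using hu⟩
    have := im_sub_arg_const hSconv.isPreconnected (L := fun x ↦ L (τ - x.1, τ + x.2)) (f := f)
      (hL.continuousOn.comp (by fun_prop) hmaps) (c := v * m) (by fun_prop) (fun x hx ↦ by
        obtain ⟨g1, g2, g3, g4, g5⟩ := hx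
        have k1 := (hP _ g1 g2).1
        have k2 := (hP _ g3 g4).2.1
        simp only [hf, Complex.add_re, Complex.re_ofReal_mul]
        rcases g1.eq_or_lt with g | g
        · rw [← g] at g5 ⊢
          have : 0 < x.2 := by linarith
          have := mul_pos this k2
          linarith
        · have := mul_pos g k1
          have := mul_nonneg g3 k2.le
          linarith)
      (fun x hx ↦ ⟨1, one_pos, by
        obtain ⟨g1, g2, g3, g4, g5⟩ := hx
        have hm' := hmaps ⟨g1, g2, g3, g4, g5⟩
        rw [hL.exp_eq _ _ hm'.1 hm'.2]
        have k1 := ha₁.secant (τ - x.1) ⟨by linarith, by linarith⟩ τ ⟨by linarith, le_rfl⟩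
        have k2 := ha₂.secant τ ⟨le_rfl, by linarith⟩ (τ + x.2) ⟨by linarith, by linarith⟩
        simp only [sub_sub_cancel] at k1
        simp only [add_sub_cancel_left] at k2
        simp only [hf, hP₁, hP₂]
        rw [show γ (τ + x.2) - γ (τ - x.1) = (γ (τ + x.2) - γ τ) + (γ τ - γ (τ - x.1)) by ring,
          k1, k2]
        push_cast
        field_simp
        ring⟩) h1 h2
    simp only [hf, Complex.ofReal_zero, zero_mul, add_zero, zero_add, sub_zero,
      Complex.arg_real_mul _ hu] at this
    exact this
  -- As `u → 0` the secants within each arc tend to the tangents, and `L` may be replaced by the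
  -- continuous `Q₁` and `Q₂`.
  have t₁ : Tendsto (fun u : ℝ ↦ (L (τ - u, τ)).im - (P₁ u).arg) (𝓝[>] 0)
      (𝓝 ((Q₁ (τ, τ)).im - (P₁ 0).arg)) := by
    refine Tendsto.sub ?_ ?_
    · have h1 : ContinuousWithinAt (fun u : ℝ ↦ (Q₁ (τ - u, τ)).im) (Icc 0 δ) 0 := by
        refine Complex.continuous_im.continuousAt.comp_continuousWithinAt ?_
        have h2 := hQ₁.continuousOn (τ, τ) ⟨hlt₁.le, le_rfl, le_rfl, by linarith⟩
        have h3 : ContinuousWithinAt (fun u : ℝ ↦ (τ - u, τ)) (Icc 0 δ) 0 := by fun_prop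
        refine ContinuousWithinAt.comp (t := triangle ℓ a τ) (by simpa using h2) h3 ?_
        rintro u ⟨g1, g2⟩
        refine ⟨?_, ?_, ?_, ?_⟩ <;> simp only <;> linarith
      have h4 := (h1.mono (Ioc_subset_Icc_self)).tendsto
      rw [nhdsWithin_Ioc_eq_nhdsGT hδ0, sub_zero] at h4
      refine h4.congr' ?_
      filter_upwards [Ioc_mem_nhdsGT hδ0] with u hu
      exact hQ₁.im_eq _ _ (by linarith [hu.2]) (by linarith [hu.1]) le_rfl (by linarith [hu.2])
    · exact ((Complex.continuousAt_arg (Or.inl p₁)).comp hc₁.continuousAt).tendsto.mono_left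
        nhdsWithin_le_nhds
  have t₂ : Tendsto (fun u : ℝ ↦ (L (τ, τ + u)).im - (P₂ u).arg) (𝓝[>] 0)
      (𝓝 ((Q₂ (τ, τ)).im - (P₂ 0).arg)) := by
    refine Tendsto.sub ?_ ?_
    · have h1 : ContinuousWithinAt (fun u : ℝ ↦ (Q₂ (τ, τ + u)).im) (Icc 0 δ) 0 := by
        refine Complex.continuous_im.continuousAt.comp_continuousWithinAt ?_
        have h2 := hQ₂.continuousOn (τ, τ) ⟨le_rfl, le_rfl, hlt₂.le, by linarith⟩
        have h3 : ContinuousWithinAt (fun u : ℝ ↦ (τ, τ + u)) (Icc 0 δ) 0 := by fun_prop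
        refine ContinuousWithinAt.comp (t := triangle ℓ τ b) (by simpa using h2) h3 ?_
        rintro u ⟨g1, g2⟩
        refine ⟨?_, ?_, ?_, ?_⟩ <;> simp only <;> linarith
      have h4 := (h1.mono (Ioc_subset_Icc_self)).tendsto
      rw [nhdsWithin_Ioc_eq_nhdsGT hδ0, add_zero] at h4
      refine h4.congr' ?_
      filter_upwards [Ioc_mem_nhdsGT hδ0] with u hu
      exact hQ₂.im_eq _ _ le_rfl (by linarith [hu.1]) (by linarith [hu.2]) (by linarith [hu.2])
    · exact ((Complex.continuousAt_arg (Or.inl p₂)).comp hc₂.continuousAt).tendsto.mono_left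
        nhdsWithin_le_nhds
  have := tendsto_nhds_unique (t₁.congr' (by
    filter_upwards [Ioc_mem_nhdsGT hδ0] with u hu using hconst u hu.1 hu.2)) t₂
  rw [a₁, a₂] at this
  linarith

/-! ### Curvature as the derivative of the tangent angle -/

/-- A continuous logarithm of a multiple of a differentiable function is differentiable. -/
theorem hasDerivWithinAt_of_exp_eq {S : Set ℝ} {M V : ℝ → ℂ} {c V' : ℂ} {t : ℝ} (hc : c ≠ 0)
    (ht : t ∈ S) (hM : ContinuousWithinAt M S t) (hexp : ∀ s ∈ S, Complex.exp (M s) = c * V s)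
    (hV : HasDerivWithinAt V V' S t) : HasDerivWithinAt M (V' / V t) S t := by
  have hV0 : ∀ s ∈ S, V s ≠ 0 := fun s hs h0 ↦ by
    have := hexp s hs
    rw [h0, mul_zero] at this
    exact Complex.exp_ne_zero _ this
  -- Near `t` the function `M` coincides with this one: by continuity `M s - M t` stays in the strip
  -- where the principal logarithm inverts `exp`.
  have h1 : HasDerivWithinAt (fun s ↦ Complex.log (V s / V t) + M t) (V' / V t) S t := by
    have := ((hV.div_const (V t)).clog_real (by
      rw [div_self (hV0 t ht)]
      exact Complex.one_mem_slitPlane)).add_const (M t)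
    simpa [div_self (hV0 t ht)] using this
  have h2 : ∀ᶠ s in 𝓝[S] t, |(M s - M t).im| < Real.pi := by
    have : ContinuousWithinAt (fun s ↦ |(M s - M t).im|) S t :=
      (Complex.continuous_im.continuousAt.comp_continuousWithinAt
        (hM.sub continuousWithinAt_const)).abs
    refine Tendsto.eventually_lt_const ?_ this
    simpa using Real.pi_pos
  refine h1.congr_of_eventuallyEq ?_ (by simp [div_self (hV0 t ht)])
  filter_upwards [h2, self_mem_nhdsWithin] with s hs hsS
  have h3 : V s / V t = Complex.exp (M s - M t) := by
    rw [Complex.exp_sub, hexp s hsS, hexp t ht]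
    have := hV0 t ht
    field_simp
  rw [abs_lt] at hs
  rw [h3, Complex.log_exp hs.1 hs.2.le, sub_add_cancel]

/-- The signed curvature is the derivative of the argument of the velocity. -/
theorem signedCurvature_mul_norm_velocity {D : Set ℝ} {M : ℝ → ℂ} {c M' : ℂ} {t : ℝ} (hc : c ≠ 0)
    (hD : UniqueDiffWithinAt ℝ D t) (ht : t ∈ D) (hM : HasDerivWithinAt M M' D t)
    (hexp : ∀ s ∈ D, Complex.exp (M s) = c * velocity γ D s) :
    signedCurvature γ D t * ‖velocity γ D t‖ = M'.im := by
  have hV0 : ‖velocity γ D t‖ ≠ 0 := fun h0 ↦ by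
    have := hexp t ht
    rw [norm_eq_zero.1 h0, mul_zero] at this
    exact Complex.exp_ne_zero _ this
  -- Up to a constant factor of modulus one, `T` is `exp (i * Im M)`; differentiation gives `dT/dt =
  -- (Im M)' N`.
  have hT : ∀ s ∈ D, unitTangent γ D s = (‖c‖ : ℝ) / c * Complex.exp ((M s).im * Complex.I) := by
    intro s hs
    have h1 : velocity γ D s = Complex.exp (M s) / c := by
      rw [hexp s hs]; field_simp
    have h2 : Complex.exp (M s) = (Real.exp (M s).re : ℝ) * Complex.exp ((M s).im * Complex.I) := by
      rw [Complex.ofReal_exp, ← Complex.exp_add, Complex.re_add_im]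
    have h3 : ‖velocity γ D s‖ = Real.exp (M s).re / ‖c‖ := by
      rw [h1, norm_div, Complex.norm_exp]
    have h4 : ((Real.exp (M s).re : ℝ) : ℂ) ≠ 0 := by exact_mod_cast (Real.exp_pos _).ne'
    rw [unitTangent, h3, h1, h2, Complex.real_smul]
    push_cast at h4 ⊢
    field_simp
  have hN1 : ‖unitNormal γ D t‖ = 1 := by
    rw [unitNormal, norm_mul, Complex.norm_I, one_mul, hT t ht, norm_mul, norm_div,
      Complex.norm_exp_ofReal_mul_I, Complex.norm_real, norm_norm, mul_one,
      div_self (norm_ne_zero_iff.2 hc)]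
  have hM2 : HasDerivWithinAt (fun s ↦ ((M s).im : ℂ)) (M'.im : ℂ) D t := by
    have h1 : HasDerivWithinAt (fun s ↦ (M s).im) M'.im D t :=
      Complex.imCLM.hasFDerivAt.comp_hasDerivWithinAt t hM
    exact h1.ofReal_comp
  have hTd : HasDerivWithinAt (unitTangent γ D) (M'.im • unitNormal γ D t) D t := by
    have h1 := ((hM2.mul_const Complex.I).cexp.const_mul ((‖c‖ : ℝ) / c)).congr hT (hT t ht)
    have h2 : M'.im • unitNormal γ D t
        = (‖c‖ : ℝ) / c * (Complex.exp ((M t).im * Complex.I) * (M'.im * Complex.I)) := by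
      rw [Complex.real_smul, unitNormal, hT t ht]
      ring
    rw [h2]
    exact h1
  rw [signedCurvature, hTd.derivWithin hD, smul_smul, real_inner_smul_left,
    real_inner_self_eq_norm_sq, hN1]
  field_simp

theorem mem_triangle_diag {a b t : ℝ} (hℓ : 0 < ℓ) (ht : t ∈ Icc a b) : (t, t) ∈ triangle ℓ a b :=
  ⟨ht.1, le_rfl, ht.2, by simpa using hℓ⟩

/-- The total signed curvature of an arc is the change of the argument of the velocity. -/
theorem IsArcLog.curvatureIntegral_eq (hℓ : 0 < ℓ) {a b : ℝ} (hab : a < b)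
    {h Q : ℝ × ℝ → ℂ} (hQ : IsArcLog ℓ L a b h Q)
    (hγ : ContDiffOn ℝ 2 γ (Icc a b)) (hh : ∀ t ∈ Icc a b, h (t, t) = velocity γ (Icc a b) t) :
    curvatureIntegral γ (Icc a b) a b = (Q (b, b)).im - (Q (a, a)).im := by
  have hU := uniqueDiffOn_Icc hab
  obtain ⟨c, hc, hexp⟩ := hQ.exp_eq
  set M : ℝ → ℂ := fun t ↦ Q (t, t) with hM
  have hMc : ContinuousOn M (Icc a b) :=
    hQ.continuousOn.comp (by fun_prop) fun t ht ↦ mem_triangle_diag hℓ ht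
  have hMexp : ∀ t ∈ Icc a b, Complex.exp (M t) = c * velocity γ (Icc a b) t := fun t ht ↦ by
    rw [← hh t ht]
    exact hexp _ (mem_triangle_diag hℓ ht)
  set V : ℝ → ℂ := velocity γ (Icc a b) with hV
  have hV1 : ContDiffOn ℝ 1 V (Icc a b) := hγ.derivWithin hU (by norm_num)
  set V' : ℝ → ℂ := derivWithin V (Icc a b) with hV'
  have hV'c : ContinuousOn V' (Icc a b) := hV1.continuousOn_derivWithin hU le_rfl
  have hV0 : ∀ t ∈ Icc a b, V t ≠ 0 := fun t ht h0 ↦ by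
    have := hMexp t ht
    rw [h0, mul_zero] at this
    exact Complex.exp_ne_zero _ this
  have hMd : ∀ t ∈ Icc a b, HasDerivWithinAt M (V' t / V t) (Icc a b) t := fun t ht ↦
    hasDerivWithinAt_of_exp_eq hc ht (hMc t ht) hMexp
      (hV1.differentiableOn one_ne_zero t ht).hasDerivWithinAt
  have hFTC := intervalIntegral.integral_eq_sub_of_hasDerivAt_of_le hab.le
    (f := fun t ↦ (M t).im) (f' := fun t ↦ (V' t / V t).im)
    (Complex.continuous_im.comp_continuousOn hMc)
    (fun t ht ↦ Complex.imCLM.hasFDerivAt.comp_hasDerivAt t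
      ((hMd t ⟨ht.1.le, ht.2.le⟩).hasDerivAt (Icc_mem_nhds ht.1 ht.2)))
    (ContinuousOn.intervalIntegrable (by
      rw [uIcc_of_le hab.le]
      exact Complex.continuous_im.comp_continuousOn (hV'c.div hV1.continuousOn hV0)))
  rw [curvatureIntegral, ← hFTC]
  refine intervalIntegral.integral_congr fun t ht ↦ ?_
  rw [uIcc_of_le hab.le] at ht
  exact signedCurvature_mul_norm_velocity hc (hU t ht) ht (hMd t ht) hMexp

/-! ### Summation over one period -/

theorem IsArc.shift (hγ : IsLoop γ ℓ) {a b : ℝ} {h : ℝ × ℝ → ℂ} (ha : IsArc γ a b h) :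
    IsArc γ (a + ℓ) (b + ℓ) (fun x ↦ h (x.1 - ℓ, x.2 - ℓ)) := by
  have hm : ∀ t ∈ Icc (a + ℓ) (b + ℓ), t - ℓ ∈ Icc a b := fun t ht ↦
    ⟨by linarith [ht.1], by linarith [ht.2]⟩
  refine ⟨by linarith [ha.lt], ?_, fun s hs t ht ↦ ?_, fun t ht ↦ ha.ne _ (hm t ht)⟩
  · have := ha.continuous
    fun_prop
  · have := ha.secant _ (hm s hs) _ (hm t ht)
    rw [hγ.periodic.sub_eq, hγ.periodic.sub_eq, sub_sub_sub_cancel_right] at this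
    exact this

/-- Translation by a period is two exchanges and raises the argument of the secant by `2 * B`; the
logarithm of the translated arc has to be raised likewise. This serves the joint between the last
arc and the first. -/
theorem IsArcLog.shift (hL : IsSecantLog γ ℓ L B) {a b : ℝ} {h Q : ℝ × ℝ → ℂ}
    (hQ : IsArcLog ℓ L a b h Q) : IsArcLog ℓ L (a + ℓ) (b + ℓ) (fun x ↦ h (x.1 - ℓ, x.2 - ℓ))
      (fun x ↦ Q (x.1 - ℓ, x.2 - ℓ) + (2 * B : ℝ) * Complex.I) := by
  have hm : MapsTo (fun x : ℝ × ℝ ↦ (x.1 - ℓ, x.2 - ℓ)) (triangle ℓ (a + ℓ) (b + ℓ))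
      (triangle ℓ a b) := by
    rintro x ⟨h1, h2, h3, h4⟩
    refine ⟨?_, ?_, ?_, ?_⟩ <;> simp only <;> linarith
  refine ⟨(hQ.continuousOn.comp (by fun_prop) hm).add continuousOn_const, ?_, ?_⟩
  · intro s t h1 h2 h3 h4
    have e1 := hQ.im_eq (s - ℓ) (t - ℓ) (by linarith) (by linarith) (by linarith) (by linarith)
    have e2 := hL.shift (s := s - ℓ) (t := t - ℓ) (by linarith) (by linarith)
    simp only [sub_add_cancel] at e2
    simp only [Complex.add_im, Complex.im_ofReal_mul, Complex.I_im]
    linarith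
  · obtain ⟨c, hc, h⟩ := hQ.exp_eq
    refine ⟨c * Complex.exp ((2 * B : ℝ) * Complex.I), mul_ne_zero hc (Complex.exp_ne_zero _),
      fun x hx ↦ ?_⟩
    rw [Complex.exp_add, h _ (hm hx)]
    ring

/-- The changes of the argument along the arcs and at the joints add up to `2 * B`. -/
theorem sum_arcLog_eq (hγ : IsLoop γ ℓ) (hL : IsSecantLog γ ℓ L B) {n : ℕ} (hn : 0 < n)
    {τ : Fin (n + 1) → ℝ} (hτ : τ (Fin.last n) = τ 0 + ℓ) {h Q : Fin n → ℝ × ℝ → ℂ}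
    (ha : ∀ i, IsArc γ (τ i.castSucc) (τ i.succ) (h i))
    (hQ : ∀ i, IsArcLog ℓ L (τ i.castSucc) (τ i.succ) (h i) (Q i)) {θ : Fin n → ℝ}
    (hθ : ∀ i, θ i = Complex.arg (h (finRotate n i) (τ (finRotate n i).castSucc,
      τ (finRotate n i).castSucc) / h i (τ i.succ, τ i.succ)))
    (hθπ : ∀ i, θ i ≠ Real.pi) :
    ∑ i, ((Q i (τ i.succ, τ i.succ)).im - (Q i (τ i.castSucc, τ i.castSucc)).im) + ∑ i, θ i
      = 2 * B := by
  obtain ⟨m, rfl⟩ : ∃ m, n = m + 1 := ⟨n - 1, by omega⟩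
  set P : Fin (m + 1) → ℝ := fun i ↦ (Q i (τ i.castSucc, τ i.castSucc)).im with hP
  -- The sum telescopes cyclically. At the last joint the next arc is the first one translated by a
  -- period, whence the single term `2 * B`.
  have key : ∀ i, θ i = P (finRotate _ i) - (Q i (τ i.succ, τ i.succ)).im
      + if i = Fin.last m then 2 * B else 0 := by
    intro i
    specialize hθ i
    specialize hθπ i
    rw [hθ] at hθπ ⊢
    split_ifs with hi
    · subst hi
      rw [finRotate_last] at hθπ ⊢
      have hs : τ (Fin.last m).succ = τ (Fin.castSucc (0 : Fin (m + 1))) + ℓ := by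
        rw [Fin.succ_last, hτ]; rfl
      have a1 := ha (Fin.last m)
      have q1 := hQ (Fin.last m)
      rw [hs] at a1 q1 hθπ ⊢
      have := IsArcLog.joint hγ.pos hL a1 ((ha 0).shift hγ) q1 ((hQ 0).shift hL)
        (by simpa only [add_sub_cancel_right] using hθπ)
      simp only [add_sub_cancel_right, Complex.add_im, Complex.im_ofReal_mul, Complex.I_im] at this
      rw [← this]
      simp only [hP]
      ring
    · have hs : (finRotate (m + 1) i).castSucc = i.succ := by
        have hi' : (i : ℕ) < m := by
          rcases i with ⟨i, hi2⟩
          simp [Fin.ext_iff] at hi ⊢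
          omega
        ext
        rw [Fin.val_castSucc, coe_finRotate_of_ne_last hi, Fin.val_succ]
      have a2 := ha (finRotate (m + 1) i)
      have q2 := hQ (finRotate (m + 1) i)
      simp only [hP]
      rw [hs] at a2 q2 hθπ ⊢
      have := IsArcLog.joint hγ.pos hL (ha i) a2 (hQ i) q2 hθπ
      rw [← this]
      ring
  have hsum : ∑ i, P (finRotate _ i) = ∑ i, P i := Equiv.sum_comp (finRotate (m + 1)) P
  simp only [key, Finset.sum_add_distrib, Finset.sum_sub_distrib, hsum, Finset.sum_ite_eq',
    Finset.mem_univ, if_true]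
  simp only [hP]
  ring

/-! ### Winding angles and the components of the complement -/

/-- The argument of `γ - p` changes by `w` along a period of `γ`. -/
def HasWindingAngle (γ : ℝ → ℂ) (ℓ : ℝ) (p : ℂ) (w : ℝ) : Prop :=
  ∃ M : ℝ → ℂ, Continuous M ∧ (∀ t, Complex.exp (M t) = γ t - p) ∧
    ∀ t, (M (t + ℓ)).im = (M t).im + w

theorem HasWindingAngle.notMem {p : ℂ} {w : ℝ} (h : HasWindingAngle γ ℓ p w) : p ∉ range γ := by
  rintro ⟨t, rfl⟩
  obtain ⟨M, -, hM, -⟩ := h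
  simpa using hM t

theorem IsLoop.isCompact_range (hγ : IsLoop γ ℓ) : IsCompact (range γ) :=
  hγ.periodic.compact_of_continuous hγ.pos.ne' hγ.continuous

/-- The point is treated as a second variable: one logarithm on `ℝ × ball` serves all nearby points,
and its change over a period is constant on this connected set. -/
theorem IsLoop.hasWindingAngle_of_nhds (hγ : IsLoop γ ℓ) {p : ℂ} (hp : p ∉ range γ) :
    ∃ w, ∀ᶠ q in 𝓝 p, HasWindingAngle γ ℓ q w := by
  obtain ⟨r, hr, hball⟩ := Metric.isOpen_iff.1 hγ.isCompact_range.isClosed.isOpen_compl p hp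
  have hc := hγ.continuous
  have hconv : Convex ℝ ((univ : Set ℝ) ×ˢ Metric.ball p r) := convex_univ.prod (convex_ball p r)
  obtain ⟨M, hM, hexp⟩ := exists_continuousOn_log hconv (f := fun x ↦ γ x.1 - x.2) (by fun_prop)
    (fun x hx h0 ↦ hball hx.2 ⟨x.1, sub_eq_zero.1 h0⟩)
  have hmaps : MapsTo (fun x : ℝ × ℂ ↦ (x.1 + ℓ, x.2)) ((univ : Set ℝ) ×ˢ Metric.ball p r)
      ((univ : Set ℝ) ×ˢ Metric.ball p r) := fun x hx ↦ ⟨mem_univ _, hx.2⟩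
  refine ⟨(M (0 + ℓ, p)).im - (M (0, p)).im, ?_⟩
  filter_upwards [Metric.ball_mem_nhds p hr] with q hq
  refine ⟨fun t ↦ M (t, q), ?_, fun t ↦ hexp _ ⟨mem_univ _, hq⟩, fun t ↦ ?_⟩
  · exact hM.comp_continuous (by fun_prop) fun t ↦ ⟨mem_univ _, hq⟩
  · have := im_sub_im_const hconv.isPreconnected (L := fun x ↦ M (x.1 + ℓ, x.2)) (M := M)
      (hM.comp (by fun_prop) hmaps) hM (c := 1) (r := fun _ ↦ 1) (fun _ _ ↦ one_pos)
      (fun x hx ↦ by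
        rw [hexp _ (hmaps hx), hexp x hx]
        simp [hγ.periodic x.1])
      (show (t, q) ∈ _ from ⟨mem_univ _, hq⟩)
      (show ((0 : ℝ), p) ∈ _ from ⟨mem_univ _, Metric.mem_ball_self hr⟩)
    simp only at this
    linarith

/-- The winding angle can be read off from a logarithm defined over a single period only. -/
theorem HasWindingAngle.sub_eq {p : ℂ} {w t₀ : ℝ} (hℓ : 0 < ℓ) (h : HasWindingAngle γ ℓ p w)
    {G : ℝ → ℂ} (hG : ContinuousOn G (Icc t₀ (t₀ + ℓ)))
    (hexp : ∀ t ∈ Icc t₀ (t₀ + ℓ), Complex.exp (G t) = γ t - p) :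
    (G (t₀ + ℓ)).im - (G t₀).im = w := by
  obtain ⟨M, hM, hMexp, hw⟩ := h
  have := im_sub_im_const isPreconnected_Icc hG hM.continuousOn (c := 1) (r := fun _ ↦ 1)
    (fun _ _ ↦ one_pos) (fun t ht ↦ by rw [hexp t ht, hMexp t]; simp)
    (right_mem_Icc.2 (by linarith)) (left_mem_Icc.2 (by linarith))
  linarith [hw t₀]

theorem HasWindingAngle.unique {p : ℂ} {w w' : ℝ} (hℓ : 0 < ℓ) (h : HasWindingAngle γ ℓ p w)
    (h' : HasWindingAngle γ ℓ p w') : w = w' := by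
  obtain ⟨M, hM, hMexp, hw⟩ := h
  rw [← h'.sub_eq (t₀ := 0) hℓ hM.continuousOn fun t _ ↦ hMexp t]
  linarith [hw 0]

theorem IsLoop.isOpen_hasWindingAngle (hγ : IsLoop γ ℓ) (w : ℝ) :
    IsOpen {p | HasWindingAngle γ ℓ p w} := by
  refine isOpen_iff_mem_nhds.2 fun p hp ↦ ?_
  obtain ⟨w', h⟩ := hγ.hasWindingAngle_of_nhds (HasWindingAngle.notMem hp)
  rwa [HasWindingAngle.unique hγ.pos hp h.self_of_nhds]

/-- The angle is locally constant, so the points with angle `w` form an open and relatively closed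
subset of the complement. -/
theorem IsLoop.hasWindingAngle_of_isPreconnected (hγ : IsLoop γ ℓ) {S : Set ℂ}
    (hS : IsPreconnected S) (hsub : S ⊆ (range γ)ᶜ) {p q : ℂ} (hp : p ∈ S) (hq : q ∈ S) {w : ℝ}
    (h : HasWindingAngle γ ℓ p w) : HasWindingAngle γ ℓ q w := by
  refine hS.subset_of_closure_inter_subset (hγ.isOpen_hasWindingAngle w) ⟨p, hp, h⟩ ?_ hq
  rintro x ⟨hx, hxS⟩
  obtain ⟨w', hw'⟩ := hγ.hasWindingAngle_of_nhds (hsub hxS)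
  obtain ⟨y, hy1, hy2⟩ := (mem_closure_iff_frequently.1 hx).and_eventually hw' |>.exists
  have := HasWindingAngle.unique hγ.pos hy1 hy2
  exact this ▸ hw'.self_of_nhds

/-- Here `1 - γ t / p` stays in the right half plane, where its principal logarithm is continuous
and inherits the period. -/
theorem IsLoop.hasWindingAngle_of_norm_lt (hγ : IsLoop γ ℓ) {p : ℂ} (hp : ∀ t, ‖γ t‖ < ‖p‖) :
    HasWindingAngle γ ℓ p 0 := by
  have hp0 : p ≠ 0 := norm_pos_iff.1 ((norm_nonneg _).trans_lt (hp 0))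
  have hre : ∀ t, 0 < (1 - γ t / p).re := fun t ↦ by
    have h1 : ‖γ t / p‖ < 1 := by
      rw [norm_div, div_lt_one (norm_pos_iff.2 hp0)]
      exact hp t
    have := (Complex.re_le_norm (γ t / p)).trans_lt h1
    simpa using this
  have hc := hγ.continuous
  refine ⟨fun t ↦ Complex.log (-p) + Complex.log (1 - γ t / p), ?_, fun t ↦ ?_, fun t ↦ ?_⟩
  · exact continuous_const.add (Continuous.clog (by fun_prop) fun t ↦ Or.inl (hre t))
  · rw [Complex.exp_add, Complex.exp_log (neg_ne_zero.2 hp0), Complex.exp_log]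
    · field_simp
      ring
    · intro h0
      have := hre t
      rw [h0] at this
      simp at this
  · simp [hγ.periodic t]

theorem IsLoop.hasWindingAngle_of_not_isBounded (hγ : IsLoop γ ℓ) {p : ℂ} (hp : p ∉ range γ)
    (h : ¬ Bornology.IsBounded (connectedComponentIn (range γ)ᶜ p)) : HasWindingAngle γ ℓ p 0 := by
  obtain ⟨R, hR⟩ := hγ.isCompact_range.isBounded.exists_norm_le
  obtain ⟨q, hq, hqR⟩ : ∃ q ∈ connectedComponentIn (range γ)ᶜ p, R < ‖q‖ := by
    by_contra! hcon
    exact h (isBounded_iff_forall_norm_le.2 ⟨R, hcon⟩)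
  exact hγ.hasWindingAngle_of_isPreconnected isPreconnected_connectedComponentIn
    (connectedComponentIn_subset _ _) hq (mem_connectedComponentIn hp)
    (hγ.hasWindingAngle_of_norm_lt fun t ↦ (hR _ ⟨t, rfl⟩).trans_lt hqR)

theorem IsLoop.mem_boundedRegion (hγ : IsLoop γ ℓ) {p : ℂ} {w : ℝ} (hw : w ≠ 0)
    (h : HasWindingAngle γ ℓ p w) : p ∈ boundedRegion (range γ) := by
  refine ⟨h.notMem, ?_⟩
  by_contra hcon
  exact hw (h.unique hγ.pos (hγ.hasWindingAngle_of_not_isBounded h.notMem hcon))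

/-! ### The winding angle on the two sides of a smooth point -/

theorem arg_one_add_I : (1 + Complex.I).arg = Real.pi / 4 := by
  rw [Complex.arg_of_re_nonneg (by simp)]
  have : ‖1 + Complex.I‖ = √2 := by
    rw [Complex.norm_def, Complex.normSq_apply]
    norm_num
  rw [this, ← Real.arcsin_sin (x := Real.pi / 4) (by linarith [Real.pi_pos])
    (by linarith [Real.pi_pos]), Real.sin_pi_div_four]
  congr 1
  simp
  field_simp
  norm_num

theorem arg_one_sub_I : (1 - Complex.I).arg = -(Real.pi / 4) := by
  have h : 1 - Complex.I = (starRingEnd ℂ) (1 + Complex.I) := by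
    simp [sub_eq_add_neg]
  rw [h, Complex.arg_conj, if_neg, arg_one_add_I]
  rw [arg_one_add_I]
  linarith [Real.pi_pos]

/-- No multiple of `2π` intervenes, as `|arg z| < π / 2`. -/
theorem arg_mul_one_add_I {z : ℂ} (hz : 0 < z.re) :
    (z * (1 + Complex.I)).arg = z.arg + Real.pi / 4 := by
  have h1 := abs_lt.1 (Complex.abs_arg_lt_pi_div_two_iff.2 (Or.inl hz))
  rw [Complex.arg_mul, arg_one_add_I]
  · rintro rfl; simp at hz
  · intro h
    simpa using congrArg Complex.re h
  · rw [arg_one_add_I]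
    constructor <;> linarith [Real.pi_pos]

theorem arg_mul_one_sub_I {z : ℂ} (hz : 0 < z.re) :
    (z * (1 - Complex.I)).arg = z.arg - Real.pi / 4 := by
  have h1 := abs_lt.1 (Complex.abs_arg_lt_pi_div_two_iff.2 (Or.inl hz))
  rw [Complex.arg_mul, arg_one_sub_I, sub_eq_add_neg]
  · rintro rfl; simp at hz
  · intro h
    simpa using congrArg Complex.re h
  · rw [arg_one_sub_I]
    constructor <;> linarith [Real.pi_pos]

/-- The angles by which the difference quotients near an interior point of an arc deviate from the
velocity are less than `π / 4`. -/
theorem IsArc.exists_forall_abs_im_lt_re {a b t₀ : ℝ} {h : ℝ × ℝ → ℂ} (ha : IsArc γ a b h)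
    (ht : t₀ ∈ Ioo a b) : ∃ δ > 0, Icc (t₀ - δ) (t₀ + δ) ⊆ Icc a b ∧
      ∀ s ∈ Icc (t₀ - δ) (t₀ + δ), ∀ t ∈ Icc (t₀ - δ) (t₀ + δ),
        |(h (s, t) / h (t₀, t₀)).im| < (h (s, t) / h (t₀, t₀)).re := by
  have hv := ha.ne t₀ ⟨ht.1.le, ht.2.le⟩
  have hc := ha.continuous
  have h1 : ∀ᶠ x in 𝓝 (t₀, t₀), |(h x / h (t₀, t₀)).im| < (h x / h (t₀, t₀)).re := by
    refine ContinuousAt.eventually_lt (f := fun x ↦ |(h x / h (t₀, t₀)).im|)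
      (g := fun x ↦ (h x / h (t₀, t₀)).re) ?_ ?_ ?_
    · exact (Complex.continuous_im.comp (hc.div_const _)).abs.continuousAt
    · exact (Complex.continuous_re.comp (hc.div_const _)).continuousAt
    · simp [div_self hv]
  obtain ⟨ε, hε, hball⟩ := Metric.eventually_nhds_iff_ball.1 h1
  have hm1 : 0 < t₀ - a := sub_pos.2 ht.1
  have hm2 : 0 < b - t₀ := sub_pos.2 ht.2
  refine ⟨min (ε / 2) (min (t₀ - a) (b - t₀)), by positivity, ?_, ?_⟩
  · refine Icc_subset_Icc ?_ ?_
    · linarith [(min_le_right (ε / 2) _).trans (min_le_left (t₀ - a) (b - t₀))]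
    · linarith [(min_le_right (ε / 2) _).trans (min_le_right (t₀ - a) (b - t₀))]
  · intro s hs t ht'
    have h2 := min_le_left (ε / 2) (min (t₀ - a) (b - t₀))
    refine hball _ ?_
    rw [← ball_prod_same, Real.ball_eq_Ioo]
    exact ⟨⟨by linarith [hs.1], by linarith [hs.2]⟩, by linarith [ht'.1], by linarith [ht'.2]⟩

/-- This gap keeps a sufficiently short normal displacement of `γ t₀` off the part of the loop away
from `t₀`. -/
theorem IsLoop.exists_forall_lt_norm_sub (hγ : IsLoop γ ℓ) (t₀ : ℝ) {δ : ℝ} (hδ : 0 < δ) :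
    ∃ m > 0, ∀ t ∈ Icc (t₀ + δ) (t₀ + ℓ - δ), m ≤ ‖γ t - γ t₀‖ := by
  have hc := hγ.continuous
  have hne : ∀ t ∈ Icc (t₀ + δ) (t₀ + ℓ - δ), 0 < ‖γ t - γ t₀‖ := fun t ht ↦
    norm_pos_iff.2 (sub_ne_zero.2 (hγ.ne t₀ t (by linarith [ht.1]) (by linarith [ht.2])).symm)
  rcases (Icc (t₀ + δ) (t₀ + ℓ - δ)).eq_empty_or_nonempty with he | hn
  · exact ⟨1, one_pos, by simp [he]⟩
  · obtain ⟨x, hx, hmin⟩ := isCompact_Icc.exists_isMinOn hn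
      (f := fun t ↦ ‖γ t - γ t₀‖) (by fun_prop)
    exact ⟨_, hne x hx, fun t ht ↦ hmin ht⟩

/-- A periodic strip without the two points of the lower edge that lie over `t₀`. -/
def punctured (t₀ ℓ ε : ℝ) : Set (ℝ × ℝ) :=
  {x | t₀ ≤ x.1 ∧ x.1 ≤ t₀ + ℓ ∧ 0 ≤ x.2 ∧ x.2 ≤ ε ∧ t₀ < x.1 + x.2 ∧ x.1 < t₀ + ℓ + x.2}

theorem convex_punctured (t₀ ℓ ε : ℝ) : Convex ℝ (punctured t₀ ℓ ε) := by
  rintro ⟨s, t⟩ ⟨h1, h2, h3, h4, h5, h6⟩ ⟨s', t'⟩ ⟨g1, g2, g3, g4, g5, g6⟩ p q hp hq hpq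
  simp only [punctured, mem_ofPred_eq, Prod.smul_mk, Prod.mk_add_mk, smul_eq_mul] at *
  obtain rfl : q = 1 - p := by linarith
  refine ⟨by nlinarith, by nlinarith, by nlinarith, by nlinarith, ?_⟩
  rcases hp.eq_or_lt with rfl | hp
  · constructor <;> nlinarith
  · constructor <;> nlinarith [mul_pos hp (sub_pos.2 h5), mul_pos hp (sub_pos.2 h6)]

/-- The winding angle about a point slightly to the left of a smooth point of a loop. -/
theorem IsArc.eventually_hasWindingAngle_left (hγ : IsLoop γ ℓ) (hL : IsSecantLog γ ℓ L B)
    {a b t₀ : ℝ} {h : ℝ × ℝ → ℂ} (ha : IsArc γ a b h) (ht₀ : t₀ ∈ Ioo a b) :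
    ∀ᶠ ε : ℝ in 𝓝[>] 0,
      HasWindingAngle γ ℓ (γ t₀ + ε • (Complex.I * h (t₀, t₀))) (B + Real.pi) := by
  have hℓ := hγ.pos
  have hc := hγ.continuous
  obtain ⟨δ', hδ'0, hsub', hδ'⟩ := ha.exists_forall_abs_im_lt_re ht₀
  obtain ⟨δ, hδ0, hδℓ, hsub, hδ⟩ : ∃ δ > 0, δ < ℓ / 2 ∧ Icc (t₀ - δ) (t₀ + δ) ⊆ Icc a b ∧
      ∀ s ∈ Icc (t₀ - δ) (t₀ + δ), ∀ t ∈ Icc (t₀ - δ) (t₀ + δ),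
        |(h (s, t) / h (t₀, t₀)).im| < (h (s, t) / h (t₀, t₀)).re := by
    have h1 := min_le_left δ' (ℓ / 3)
    have h2 : Icc (t₀ - min δ' (ℓ / 3)) (t₀ + min δ' (ℓ / 3)) ⊆ Icc (t₀ - δ') (t₀ + δ') :=
      Icc_subset_Icc (by linarith) (by linarith)
    exact ⟨min δ' (ℓ / 3), by positivity, (min_le_right _ _).trans_lt (by linarith),
      h2.trans hsub', fun s hs t ht ↦ hδ' s (h2 hs) t (h2 ht)⟩
  set v := h (t₀, t₀) with hv
  have hv0 : v ≠ 0 := ha.ne t₀ ⟨ht₀.1.le, ht₀.2.le⟩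
  obtain ⟨m, hm0, hm⟩ := hγ.exists_forall_lt_norm_sub t₀ hδ0
  have hε : ∀ᶠ ε : ℝ in 𝓝[>] 0, ε < m / ‖v‖ :=
    eventually_nhdsWithin_of_eventually_nhds
      (eventually_lt_nhds (div_pos hm0 (norm_pos_iff.2 hv0)))
  filter_upwards [hε, self_mem_nhdsWithin] with ε hεm hε0
  rw [mem_Ioi] at hε0
  set z₁ : ℝ → ℂ := fun t ↦ h (t₀, t) / v with hz₁
  set z₂ : ℝ → ℂ := fun t ↦ h (t, t₀) / v with hz₂
  have hz₁c : Continuous z₁ := by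
    have := ha.continuous
    fun_prop
  have hz₂c : Continuous z₂ := by
    have := ha.continuous
    fun_prop
  -- On the lower edge `g` is the secant from `γ t₀`, governed by `L`; on the upper edge it is `γ`
  -- minus the displaced point, whose change of argument is wanted. Only the two lower corners are
  -- zeros.
  set g : ℝ × ℝ → ℂ := fun x ↦ γ x.1 - γ t₀ - x.2 * (Complex.I * v) with hg
  have hmem₀ : t₀ ∈ Icc (t₀ - δ) (t₀ + δ) := ⟨by linarith, by linarith⟩
  -- the two local normal forms
  set f₁ : ℝ × ℝ → ℂ := fun x ↦ ((x.1 - t₀ : ℝ) : ℂ) * (z₁ x.1 * (1 + Complex.I))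
    + (x.2 : ℂ) * (1 - Complex.I) with hf₁
  set f₂ : ℝ × ℝ → ℂ := fun x ↦ ((t₀ + ℓ - x.1 : ℝ) : ℂ) * (z₂ (x.1 - ℓ) * (1 - Complex.I))
    + (x.2 : ℂ) * (1 + Complex.I) with hf₂
  -- Near the left end `g` is a combination of a vector close to `v` and of `-I * v`. Division by
  -- `v` and multiplication by `1 + I` turn the bisector of these two to the positive real axis.
  -- Near the right end `v` is replaced by `-v`, and the factor is `-1 + I`.
  have hgf₁ : ∀ x : ℝ × ℝ, x.1 ∈ Icc (t₀ - δ) (t₀ + δ) →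
      g x = v * (1 + Complex.I)⁻¹ * f₁ x := fun x hx ↦ by
    have h1 := ha.secant t₀ (hsub hmem₀) x.1 (hsub hx)
    have h2 : (1 + Complex.I) ≠ 0 := fun h ↦ by simpa using congrArg Complex.re h
    have h3 : v * (1 + Complex.I)⁻¹ * f₁ x = (1 + Complex.I)⁻¹ * (1 + Complex.I) *
        (((x.1 - t₀ : ℝ) : ℂ) * (v * z₁ x.1))
        + (1 + Complex.I)⁻¹ * v * ((x.2 : ℂ) * (1 - Complex.I)) := by
      simp only [hf₁]; ring
    have h4 : (1 - Complex.I) = (1 + Complex.I) * (-Complex.I) := by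
      ring_nf
      rw [Complex.I_sq]
      ring
    have h5 : v * z₁ x.1 = h (t₀, x.1) := by
      simp only [hz₁]; field_simp
    rw [h3, inv_mul_cancel₀ h2, one_mul, h5, ← h1, h4]
    simp only [hg]
    field_simp
    ring
  have hgf₂ : ∀ x : ℝ × ℝ, x.1 - ℓ ∈ Icc (t₀ - δ) (t₀ + δ) →
      g x = v * (-1 + Complex.I)⁻¹ * f₂ x := fun x hx ↦ by
    have h1 := ha.secant (x.1 - ℓ) (hsub hx) t₀ (hsub hmem₀)
    have h2 : (-1 + Complex.I) ≠ 0 := fun h ↦ by simpa using congrArg Complex.re h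
    have h3 : v * (-1 + Complex.I)⁻¹ * f₂ x = -((-1 + Complex.I)⁻¹ * (-1 + Complex.I) *
        (((t₀ + ℓ - x.1 : ℝ) : ℂ) * (v * z₂ (x.1 - ℓ))))
        + (-1 + Complex.I)⁻¹ * v * ((x.2 : ℂ) * (1 + Complex.I)) := by
      simp only [hf₂]; ring
    have h4 : (1 + Complex.I) = (-1 + Complex.I) * (-Complex.I) := by
      ring_nf
      rw [Complex.I_sq]
      ring
    have h5 : v * z₂ (x.1 - ℓ) = h (x.1 - ℓ, t₀) := by
      simp only [hz₂]; field_simp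
    have h6 : t₀ + ℓ - x.1 = t₀ - (x.1 - ℓ) := by ring
    rw [h3, inv_mul_cancel₀ h2, one_mul, h5, h6, ← h1, h4, hγ.periodic.sub_eq]
    simp only [hg]
    field_simp
    ring
  have hpos₁ : ∀ x : ℝ × ℝ, t₀ ≤ x.1 → x.1 ≤ t₀ + δ → 0 ≤ x.2 → t₀ < x.1 + x.2 →
      0 < (f₁ x).re := fun x h1 h2 h3 h4 ↦ by
    have k := (abs_lt.1 (hδ t₀ hmem₀ x.1 ⟨by linarith, h2⟩)).2
    have k1 : 0 < (z₁ x.1).re - (z₁ x.1).im := sub_pos.2 k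
    have k2 : (f₁ x).re = (x.1 - t₀) * ((z₁ x.1).re - (z₁ x.1).im) + x.2 := by
      simp [hf₁, Complex.add_re, Complex.mul_re]
    rw [k2]
    rcases h1.eq_or_lt with h1 | h1
    · rw [← h1] at h4 ⊢
      linarith
    · have := mul_pos (sub_pos.2 h1) k1
      linarith
  have hpos₂ : ∀ x : ℝ × ℝ, t₀ + ℓ - δ ≤ x.1 → x.1 ≤ t₀ + ℓ → 0 ≤ x.2 → x.1 < t₀ + ℓ + x.2 →
      0 < (f₂ x).re := fun x h1 h2 h3 h4 ↦ by
    have k := (abs_lt.1 (hδ (x.1 - ℓ) ⟨by linarith, by linarith⟩ t₀ hmem₀)).1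
    have k1 : 0 < (z₂ (x.1 - ℓ)).re + (z₂ (x.1 - ℓ)).im := by
      simp only [hz₂]
      linarith
    have k2 : (f₂ x).re = (t₀ + ℓ - x.1) * ((z₂ (x.1 - ℓ)).re + (z₂ (x.1 - ℓ)).im) + x.2 := by
      simp [hf₂, Complex.add_re, Complex.mul_re]
    rw [k2]
    rcases h2.eq_or_lt with h2 | h2
    · rw [h2] at h4 ⊢
      linarith
    · have := mul_pos (sub_pos.2 h2) k1
      linarith
  have hg0 : ∀ x ∈ punctured t₀ ℓ ε, g x ≠ 0 := by
    rintro x ⟨h1, h2, h3, h4, h5, h6⟩ h0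
    rcases le_or_gt x.1 (t₀ + δ) with h7 | h7
    · have k := hpos₁ x h1 h7 h3 h5
      rw [hgf₁ x ⟨by linarith, h7⟩] at h0
      have h8 : (1 + Complex.I)⁻¹ ≠ 0 := inv_ne_zero fun h ↦ by simpa using congrArg Complex.re h
      rw [(mul_eq_zero.1 h0).resolve_left (mul_ne_zero hv0 h8)] at k
      simp at k
    rcases le_or_gt (t₀ + ℓ - δ) x.1 with h8 | h8
    · have k := hpos₂ x h8 h2 h3 h6
      rw [hgf₂ x ⟨by linarith, by linarith⟩] at h0
      have h8 : (-1 + Complex.I)⁻¹ ≠ 0 := inv_ne_zero fun h ↦ by simpa using congrArg Complex.re h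
      rw [(mul_eq_zero.1 h0).resolve_left (mul_ne_zero hv0 h8)] at k
      simp at k
    · have k := hm x.1 ⟨h7.le, h8.le⟩
      rw [sub_eq_zero.1 h0, norm_mul, norm_mul, Complex.norm_I, one_mul, Complex.norm_real,
        Real.norm_of_nonneg h3] at k
      have : x.2 * ‖v‖ < m := by
        rw [lt_div_iff₀ (norm_pos_iff.2 hv0)] at hεm
        exact (mul_le_mul_of_nonneg_right h4 (norm_nonneg _)).trans_lt hεm
      linarith
  obtain ⟨G, hG, hGexp⟩ := exists_continuousOn_log (convex_punctured t₀ ℓ ε) (f := g)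
    (by fun_prop) hg0
  -- comparison along the lower edge
  have hbot : ∀ s ∈ Ioo t₀ (t₀ + ℓ), ∀ t ∈ Ioo t₀ (t₀ + ℓ),
      (G (s, 0)).im - (L (t₀, s)).im = (G (t, 0)).im - (L (t₀, t)).im := by
    have hm1 : MapsTo (fun t : ℝ ↦ (t, (0 : ℝ))) (Ioo t₀ (t₀ + ℓ)) (punctured t₀ ℓ ε) := by
      rintro t ⟨h1, h2⟩
      refine ⟨h1.le, h2.le, le_rfl, hε0.le, ?_, ?_⟩ <;> simp only <;> linarith
    have hm2 : MapsTo (fun t : ℝ ↦ (t₀, t)) (Ioo t₀ (t₀ + ℓ)) (strip ℓ) := fun t ht ↦ ht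
    intro s hs t ht
    refine im_sub_im_const isPreconnected_Ioo (L := fun t ↦ G (t, 0)) (M := fun t ↦ L (t₀, t))
      (hG.comp (by fun_prop) hm1) (hL.continuousOn.comp (by fun_prop) hm2) (c := 1)
      (r := fun _ ↦ 1) (fun _ _ ↦ one_pos) (fun t ht ↦ ?_) hs ht
    rw [hGexp _ (hm1 ht), hL.exp_eq _ _ ht.1 ht.2]
    simp [hg]
  -- Around a removed corner `g` stays in a half plane, so the change of `G` there is that of a
  -- principal argument.
  have hleft : (G (t₀, ε)).im - (f₁ (t₀, ε)).arg = (G (t₀ + δ, 0)).im - (f₁ (t₀ + δ, 0)).arg := by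
    refine im_sub_arg_const (S := punctured t₀ ℓ ε ∩ {x | x.1 ≤ t₀ + δ})
      ((convex_punctured t₀ ℓ ε).inter (convex_halfSpace_le (LinearMap.fst ℝ ℝ ℝ).isLinear _)
        ).isPreconnected (hG.mono inter_subset_left) (c := v * (1 + Complex.I)⁻¹) (by fun_prop)
      ?_ ?_ ?_ ?_
    · rintro x ⟨⟨h1, h2, h3, h4, h5, h6⟩, h7⟩
      exact hpos₁ x h1 h7 h3 h5
    · rintro x ⟨h1, h7⟩
      refine ⟨1, one_pos, ?_⟩
      rw [hGexp x h1, hgf₁ x ⟨by linarith [h1.1], h7⟩]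
      simp
    · refine ⟨⟨?_, ?_, ?_, ?_, ?_, ?_⟩, ?_⟩ <;> simp <;> linarith
    · refine ⟨⟨?_, ?_, ?_, ?_, ?_, ?_⟩, ?_⟩ <;> simp <;> linarith
  have hright : (G (t₀ + ℓ, ε)).im - (f₂ (t₀ + ℓ, ε)).arg
      = (G (t₀ + ℓ - δ, 0)).im - (f₂ (t₀ + ℓ - δ, 0)).arg := by
    refine im_sub_arg_const (S := punctured t₀ ℓ ε ∩ {x | t₀ + ℓ - δ ≤ x.1})
      ((convex_punctured t₀ ℓ ε).inter (convex_halfSpace_ge (LinearMap.fst ℝ ℝ ℝ).isLinear _)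
        ).isPreconnected (hG.mono inter_subset_left) (c := v * (-1 + Complex.I)⁻¹) (by fun_prop)
      ?_ ?_ ?_ ?_
    · rintro x ⟨⟨h1, h2, h3, h4, h5, h6⟩, h7⟩
      exact hpos₂ x h7 h2 h3 h6
    · rintro x ⟨h1, h7⟩
      refine ⟨1, one_pos, ?_⟩
      have h7' : t₀ + ℓ - δ ≤ x.1 := h7
      rw [hGexp x h1, hgf₂ x ⟨by linarith, by linarith [h1.2.1]⟩]
      simp
    · refine ⟨⟨?_, ?_, ?_, ?_, ?_, ?_⟩, ?_⟩ <;> simp <;> linarith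
    · refine ⟨⟨?_, ?_, ?_, ?_, ?_, ?_⟩, ?_⟩ <;> simp <;> linarith
  -- Close to `t₀` all difference quotients stay in a cone about `v`, so the backward and the
  -- forward secant at `t₀` can be compared.
  have hdiag : (L (t₀ - δ, t₀)).im - (z₂ (t₀ - δ)).arg = (L (t₀, t₀ + δ)).im - (z₁ (t₀ + δ)).arg := by
    refine im_sub_arg_const (S := triangle ℓ (t₀ - δ) (t₀ + δ) ∩ strip ℓ)
      (x := (t₀ - δ, t₀)) (y := (t₀, t₀ + δ)) (f := fun x ↦ h x / v) (c := v)
      (convex_triangle_inter _ _ _).isPreconnected (hL.continuousOn.mono inter_subset_right)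
      (ha.continuous.div_const _).continuousOn ?_ ?_ ?_ ?_
    · rintro x ⟨⟨h1, h2, h3, h4⟩, -⟩
      exact (abs_nonneg _).trans_lt (hδ x.1 ⟨h1, h2.trans h3⟩ x.2 ⟨h1.trans h2, h3⟩)
    · rintro x ⟨⟨h1, h2, h3, h4⟩, h5, h6⟩
      refine ⟨x.2 - x.1, sub_pos.2 h5, ?_⟩
      rw [hL.exp_eq x.1 x.2 h5 h6, ha.secant x.1 (hsub ⟨h1, h2.trans h3⟩) x.2
        (hsub ⟨h1.trans h2, h3⟩)]
      field_simp
    · refine ⟨⟨?_, ?_, ?_, ?_⟩, ?_, ?_⟩ <;> simp only <;> linarith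
    · refine ⟨⟨?_, ?_, ?_, ?_⟩, ?_, ?_⟩ <;> simp only <;> linarith
  have hexch : (L (t₀, t₀ + ℓ - δ)).im = (L (t₀ - δ, t₀)).im + B := by
    have := hL.exchange (t₀ - δ) t₀ (by linarith) (by linarith)
    rwa [show t₀ - δ + ℓ = t₀ + ℓ - δ by ring] at this
  have hB := hbot (t₀ + ℓ - δ) ⟨by linarith, by linarith⟩ (t₀ + δ) ⟨by linarith, by linarith⟩
  have a₁ : (f₁ (t₀, ε)).arg = -(Real.pi / 4) := by
    simp only [hf₁, sub_self, Complex.ofReal_zero, zero_mul, zero_add]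
    rw [Complex.arg_real_mul _ hε0, arg_one_sub_I]
  have a₂ : (f₂ (t₀ + ℓ, ε)).arg = Real.pi / 4 := by
    simp only [hf₂, sub_self, Complex.ofReal_zero, zero_mul, zero_add]
    rw [Complex.arg_real_mul _ hε0, arg_one_add_I]
  have hz₁pos : 0 < (z₁ (t₀ + δ)).re :=
    (abs_nonneg _).trans_lt (hδ t₀ hmem₀ (t₀ + δ) ⟨by linarith, le_rfl⟩)
  have hz₂pos : 0 < (z₂ (t₀ - δ)).re :=
    (abs_nonneg _).trans_lt (hδ (t₀ - δ) ⟨le_rfl, by linarith⟩ t₀ hmem₀)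
  have a₃ : (f₁ (t₀ + δ, 0)).arg = (z₁ (t₀ + δ)).arg + Real.pi / 4 := by
    simp only [hf₁, add_sub_cancel_left, Complex.ofReal_zero, zero_mul, add_zero]
    rw [Complex.arg_real_mul _ hδ0, arg_mul_one_add_I hz₁pos]
  have a₄ : (f₂ (t₀ + ℓ - δ, 0)).arg = (z₂ (t₀ - δ)).arg - Real.pi / 4 := by
    simp only [hf₂, sub_sub_cancel, Complex.ofReal_zero, zero_mul, add_zero]
    rw [Complex.arg_real_mul _ hδ0, show t₀ + ℓ - δ - ℓ = t₀ - δ by ring, arg_mul_one_sub_I hz₂pos]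
  -- The corners contribute `arg z₁ + π / 2` and `π / 2 - arg z₂`; by `hexch` and `hdiag` the lower
  -- edge contributes `B + arg z₂ - arg z₁`.
  have hW : (G (t₀ + ℓ, ε)).im - (G (t₀, ε)).im = B + Real.pi := by linarith
  have hgt : ∀ t, g (t, ε) = γ t - (γ t₀ + ε • (Complex.I * v)) := fun t ↦ by
    simp only [hg, Complex.real_smul]
    ring
  have hmt : MapsTo (fun t : ℝ ↦ (t, ε)) (Icc t₀ (t₀ + ℓ)) (punctured t₀ ℓ ε) := by
    rintro t ⟨h1, h2⟩
    refine ⟨h1, h2, hε0.le, le_rfl, ?_, ?_⟩ <;> simp only <;> linarith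
  have hnot : γ t₀ + ε • (Complex.I * v) ∉ range γ := by
    rintro ⟨t, ht⟩
    obtain ⟨y, hy, hyt⟩ := hγ.periodic.exists_mem_Ico hℓ t t₀
    refine hg0 (y, ε) (hmt ⟨hy.1, hy.2.le⟩) ?_
    rw [hgt, ← hyt, ht, sub_self]
  obtain ⟨w, hw⟩ := hγ.hasWindingAngle_of_nhds hnot
  have hw' := hw.self_of_nhds
  have := hw'.sub_eq hℓ (G := fun t ↦ G (t, ε)) (hG.comp (by fun_prop) hmt) fun t ht ↦ by
    rw [hGexp _ (hmt ht), hgt]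
  rw [← hW, this]
  exact hw'

/-- The winding angle about a point slightly to the right of a smooth point of a loop. -/
theorem IsArc.eventually_hasWindingAngle_right (hγ : IsLoop γ ℓ) (hL : IsSecantLog γ ℓ L B)
    {a b t₀ : ℝ} {h : ℝ × ℝ → ℂ} (ha : IsArc γ a b h) (ht₀ : t₀ ∈ Ioo a b) :
    ∀ᶠ ε : ℝ in 𝓝[>] 0,
      HasWindingAngle γ ℓ (γ t₀ - ε • (Complex.I * h (t₀, t₀))) (B - Real.pi) := by
  -- Complex conjugation interchanges left and right and changes the sign of `B` and of winding
  -- angles.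
  have hconj := Complex.continuous_conj
  have hγ' : IsLoop (fun t ↦ (starRingEnd ℂ) (γ t)) ℓ :=
    ⟨hγ.pos, fun t ↦ congrArg _ (hγ.periodic t), hconj.comp hγ.continuous, fun s t h1 h2 h3 ↦
      hγ.ne s t h1 h2 ((starRingEnd ℂ).injective h3)⟩
  have hL' : IsSecantLog (fun t ↦ (starRingEnd ℂ) (γ t)) ℓ (fun x ↦ (starRingEnd ℂ) (L x)) (-B) := by
    refine ⟨hconj.comp_continuousOn hL.continuousOn, fun s t h1 h2 ↦ ?_, fun s t h1 h2 ↦ ?_⟩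
    · rw [Complex.exp_conj, hL.exp_eq s t h1 h2, map_sub]
    · have := hL.exchange s t h1 h2
      simp only [Complex.conj_im]
      linarith
  have ha' : IsArc (fun t ↦ (starRingEnd ℂ) (γ t)) a b (fun x ↦ (starRingEnd ℂ) (h x)) := by
    refine ⟨ha.lt, hconj.comp ha.continuous, fun s hs t ht ↦ ?_, fun t ht h0 ↦ ?_⟩
    · rw [← map_sub, ha.secant s hs t ht, map_mul, Complex.conj_ofReal]
    · exact ha.ne t ht (by simpa using h0)
  filter_upwards [ha'.eventually_hasWindingAngle_left hγ' hL' ht₀] with ε hε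
  obtain ⟨M, hM, hexp, hw⟩ := hε
  refine ⟨fun t ↦ (starRingEnd ℂ) (M t), hconj.comp hM, fun t ↦ ?_, fun t ↦ ?_⟩
  · rw [Complex.exp_conj, hexp t]
    simp
    ring
  · have := hw t
    simp only [Complex.conj_im]
    linarith

/-! ### A smooth point with one side in the unbounded region -/

/-- The union of the unbounded components of the complement of `K`. -/
def unboundedRegion (K : Set ℂ) : Set ℂ :=
  {p | p ∈ Kᶜ ∧ ¬ Bornology.IsBounded (connectedComponentIn Kᶜ p)}

theorem mem_unboundedRegion_of_isPreconnected {K S : Set ℂ} (hS : IsPreconnected S)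
    (hsub : S ⊆ Kᶜ) {p q : ℂ} (hpS : p ∈ S) (hqS : q ∈ S) (hp : p ∈ unboundedRegion K) :
    q ∈ unboundedRegion K := by
  refine ⟨hsub hqS, ?_⟩
  rw [← connectedComponentIn_eq (hS.subset_connectedComponentIn hpS hsub hqS)]
  exact hp.2

theorem isOpen_unboundedRegion {K : Set ℂ} (hK : IsClosed K) : IsOpen (unboundedRegion K) := by
  refine Metric.isOpen_iff.2 fun p hp ↦ ?_
  obtain ⟨r, hr, hball⟩ := Metric.isOpen_iff.1 hK.isOpen_compl p hp.1
  exact ⟨r, hr, fun q hq ↦ mem_unboundedRegion_of_isPreconnected (convex_ball p r).isPreconnected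
    hball (Metric.mem_ball_self hr) hq hp⟩

/-- Consequently the boundary of the unbounded region lies in `K`. -/
theorem closure_unboundedRegion_inter_compl_subset {K : Set ℂ} (hK : IsClosed K) :
    closure (unboundedRegion K) ∩ Kᶜ ⊆ unboundedRegion K := by
  rintro q ⟨hq, hqK⟩
  obtain ⟨r, hr, hball⟩ := Metric.isOpen_iff.1 hK.isOpen_compl q hqK
  obtain ⟨p, hp, hpq⟩ := Metric.mem_closure_iff.1 hq r hr
  exact mem_unboundedRegion_of_isPreconnected (convex_ball q r).isPreconnected hball
    (Metric.mem_ball'.2 hpq) (Metric.mem_ball_self hr) hp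

theorem unboundedRegion_nonempty {K : Set ℂ} (hK : Bornology.IsBounded K) :
    (unboundedRegion K).Nonempty := by
  obtain ⟨R, hR⟩ := hK.exists_norm_le
  set H : Set ℂ := {z | R < z.re} with hH
  have hsub : H ⊆ Kᶜ := fun z hz hzK ↦
    absurd ((Complex.re_le_norm z).trans (hR z hzK)) (not_le.2 hz)
  have hconv : Convex ℝ H := convex_halfSpace_re_gt R
  have hmem : ((R + 1 : ℝ) : ℂ) ∈ H := by simp [hH]
  refine ⟨_, hsub hmem, fun hb ↦ ?_⟩
  obtain ⟨R', hR'⟩ := (hb.subset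
    (hconv.isPreconnected.subset_connectedComponentIn hmem hsub)).exists_norm_le
  have h1 := hR' ((max R R' + 1 : ℝ) : ℂ) (by
    simp only [hH, mem_ofPred_eq, Complex.ofReal_re]
    linarith [le_max_left R R'])
  rw [Complex.norm_real] at h1
  linarith [le_max_right R R', Real.le_norm_self (max R R' + 1)]

/-- The boundary of the unbounded region of a compact infinite set is infinite. -/
theorem exists_mem_closure_unboundedRegion {K C : Set ℂ} (hK : IsCompact K) (hC : C.Finite)
    (hKC : ¬ K ⊆ C) : ∃ q ∈ K, q ∉ C ∧ q ∈ closure (unboundedRegion K) := by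
  by_contra! hcon
  -- The plane without a finite set is connected. If the boundary points of the unbounded region all
  -- lay in `C`, that region would be open and closed relative to `Cᶜ` and would contain it, forcing
  -- `K ⊆ C`.
  have hcc : IsPreconnected Cᶜ :=
    (hC.countable.isPathConnected_compl_of_one_lt_rank
      (by rw [Complex.rank_real_complex]; norm_num)).isConnected.isPreconnected
  have hU := isOpen_unboundedRegion hK.isClosed
  have hne : (Cᶜ ∩ unboundedRegion K).Nonempty := by
    rw [inter_comm]
    have hd : Dense Cᶜ := hC.countable.dense_compl ℝ
    exact hd.inter_open_nonempty _ hU (unboundedRegion_nonempty hK.isBounded)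
  have hsub := hcc.subset_of_closure_inter_subset hU hne fun q ⟨hq1, hq2⟩ ↦ by
    by_cases hqK : q ∈ K
    · exact absurd hq1 (hcon q hqK hq2)
    · exact closure_unboundedRegion_inter_compl_subset hK.isClosed ⟨hq1, hqK⟩
  exact hKC fun x hx ↦ by_contra fun hxC ↦ (hsub hxC).1 hx

theorem IsArc.hasDerivAt {a b t₀ : ℝ} {h : ℝ × ℝ → ℂ} (ha : IsArc γ a b h) (ht₀ : t₀ ∈ Ioo a b) :
    HasDerivAt γ (h (t₀, t₀)) t₀ := by
  rw [hasDerivAt_iff_tendsto_slope]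
  have hc := ha.continuous
  have h1 : Tendsto (fun t ↦ h (t₀, t)) (𝓝[≠] t₀) (𝓝 (h (t₀, t₀))) :=
    (Continuous.tendsto (f := fun t ↦ h (t₀, t)) (by fun_prop) t₀).mono_left nhdsWithin_le_nhds
  refine h1.congr' ?_
  filter_upwards [self_mem_nhdsWithin,
    mem_nhdsWithin_of_mem_nhds (Icc_mem_nhds ht₀.1 ht₀.2)] with t ht ht'
  rw [slope_def_module, ha.secant t₀ ⟨ht₀.1.le, ht₀.2.le⟩ t ht', Complex.real_smul]
  have : ((t - t₀ : ℝ) : ℂ) ≠ 0 := by exact_mod_cast sub_ne_zero.2 ht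
  rw [← mul_assoc, Complex.ofReal_inv, inv_mul_cancel₀ this, one_mul]

/-- A vector that is orthogonal to `v` is a real multiple of `I * v`. -/
theorem exists_eq_smul_I_mul {u v : ℂ} (hv : v ≠ 0) (h : inner ℝ u v = 0) :
    ∃ c : ℝ, u = c • (Complex.I * v) := by
  refine ⟨(u / v).im, ?_⟩
  have h1 : (u / v).re = 0 := by
    rw [Complex.inner, Complex.mul_re, Complex.conj_re, Complex.conj_im] at h
    rw [Complex.div_re, ← add_div, show u.re * v.re + u.im * v.im = v.re * u.re - v.im * -u.im by ring,
      h, zero_div]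
  have h2 : u / v = ((u / v).im : ℂ) * Complex.I := by
    conv_lhs => rw [← Complex.re_add_im (u / v), h1]
    simp
  calc u = u / v * v := by field_simp
    _ = _ := by rw [h2, Complex.real_smul]; simp; ring

/-- The open ball about `p` through `q` misses `K`, and `q + ε • w` lies in it, on the segment from
`q` to `p`. -/
theorem mem_unboundedRegion_of_norm_le {K : Set ℂ} {p q w : ℂ} {c ε : ℝ}
    (hp : p ∈ unboundedRegion K) (hmin : ∀ x ∈ K, dist p q ≤ dist p x) (hpq : p - q = c • w)
    (hw : w ≠ 0) (hε : 0 < ε) (hεc : ε < c) : q + ε • w ∈ unboundedRegion K := by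
  have hd : dist p q = c * ‖w‖ := by
    rw [dist_eq_norm, hpq, norm_smul, Real.norm_of_nonneg (by linarith)]
  have hw0 := norm_pos_iff.2 hw
  refine mem_unboundedRegion_of_isPreconnected (S := Metric.ball p (dist p q))
    (convex_ball _ _).isPreconnected (fun x hx hxK ↦ ?_) (Metric.mem_ball_self ?_) ?_ hp
  · exact absurd (hmin x hxK) (not_le.2 (Metric.mem_ball'.1 hx))
  · rw [hd]; exact mul_pos (by linarith) hw0
  · rw [Metric.mem_ball', hd, dist_eq_norm, show p - (q + ε • w) = (p - q) - ε • w by ring, hpq,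
      ← sub_smul, norm_smul, Real.norm_of_nonneg (by linarith)]
    exact mul_lt_mul_of_pos_right (by linarith) hw0

theorem IsLoop.not_range_subset (hγ : IsLoop γ ℓ) {C : Set ℂ} (hC : C.Finite) :
    ¬ range γ ⊆ C := by
  intro hsub
  have hinj : InjOn γ (Ico 0 ℓ) := fun s hs t ht hst ↦ by
    rcases lt_trichotomy s t with h | h | h
    · exact absurd hst (hγ.ne s t h (by linarith [hs.1, ht.2]))
    · exact h
    · exact absurd hst.symm (hγ.ne t s h (by linarith [ht.1, hs.2]))
  exact Ico_infinite hγ.pos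
    (Finite.of_finite_image (hC.subset ((image_subset_range _ _).trans hsub)) hinj)

/-- At some smooth point of a loop, one of the two sides is in the unbounded region. -/
theorem IsLoop.exists_side_unbounded (hγ : IsLoop γ ℓ) {C : Set ℂ} (hC : C.Finite) {T : Set ℝ}
    (hT : ∀ t ∈ T, ∃ a b h, IsArc γ a b h ∧ t ∈ Ioo a b) (hCT : range γ \ C ⊆ γ '' T) :
    ∃ t ∈ T, ∃ a b h, IsArc γ a b h ∧ t ∈ Ioo a b ∧
      ((∀ᶠ ε : ℝ in 𝓝[>] 0, γ t + ε • (Complex.I * h (t, t)) ∈ unboundedRegion (range γ)) ∨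
        ∀ᶠ ε : ℝ in 𝓝[>] 0, γ t - ε • (Complex.I * h (t, t)) ∈ unboundedRegion (range γ)) := by
  have hK := hγ.isCompact_range
  obtain ⟨q₀, hq₀K, hq₀C, hq₀⟩ := exists_mem_closure_unboundedRegion hK hC (hγ.not_range_subset hC)
  obtain ⟨r, hr, hball⟩ := Metric.isOpen_iff.1 hC.isClosed.isOpen_compl q₀ hq₀C
  -- With `p` within `r / 2` of `q₀`, a nearest point `q` of the curve lies within `r` of `q₀`,
  -- hence is not exceptional.
  obtain ⟨p, hp, hpq₀⟩ := Metric.mem_closure_iff.1 hq₀ (r / 2) (by positivity)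
  obtain ⟨q, hqK, hq⟩ := hK.exists_infDist_eq_dist ⟨q₀, hq₀K⟩ p
  have hmin : ∀ x ∈ range γ, dist p q ≤ dist p x := fun x hx ↦
    hq ▸ Metric.infDist_le_dist_of_mem hx
  have hqC : q ∉ C := hball (by
    have h1 := hmin q₀ hq₀K
    have h2 := dist_triangle_left q q₀ p
    rw [dist_comm] at hpq₀
    exact Metric.mem_ball.2 (by linarith))
  obtain ⟨t, htT, rfl⟩ := hCT ⟨hqK, hqC⟩
  obtain ⟨a, b, h, ha, ht⟩ := hT t htT
  have hv : h (t, t) ≠ 0 := ha.ne t ⟨ht.1.le, ht.2.le⟩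
  -- The squared distance from `p` is minimal at `t`, so `p` lies on the normal line; the sign of
  -- `c` tells on which side.
  have horth : inner ℝ (γ t - p) (h (t, t)) = 0 := by
    have h1 := ((ha.hasDerivAt ht).sub_const p).norm_sq
    have h2 : IsLocalMin (fun s ↦ ‖γ s - p‖ ^ 2) t := Eventually.of_forall fun s ↦ by
      have := hmin (γ s) ⟨s, rfl⟩
      rw [dist_comm p, dist_comm p, dist_eq_norm, dist_eq_norm] at this
      exact pow_le_pow_left₀ (norm_nonneg _) this 2
    have := h2.hasDerivAt_eq_zero h1
    linarith
  obtain ⟨c, hc⟩ := exists_eq_smul_I_mul hv horth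
  have hw : Complex.I * h (t, t) ≠ 0 := mul_ne_zero Complex.I_ne_zero hv
  refine ⟨t, htT, a, b, h, ha, ht, ?_⟩
  rcases lt_trichotomy c 0 with hc0 | hc0 | hc0
  · left
    filter_upwards [Ioo_mem_nhdsGT (neg_pos.2 hc0)] with ε hε
    exact mem_unboundedRegion_of_norm_le hp hmin
      (by rw [← neg_sub, hc, neg_smul]) hw hε.1 hε.2
  · rw [hc0, zero_smul, sub_eq_zero] at hc
    exact absurd ⟨t, hc⟩ hp.1
  · right
    filter_upwards [Ioo_mem_nhdsGT hc0] with ε hε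
    rw [sub_eq_add_neg, ← smul_neg]
    exact mem_unboundedRegion_of_norm_le hp hmin
      (by rw [← neg_sub, hc, smul_neg]) (neg_ne_zero.2 hw) hε.1 hε.2

/-! ### The value of the exchange constant and the orientation -/

/-- The two orientations of a loop: the argument of the secant changes by `π` under the exchange of
its end points if the bounded region is on the left, and by `-π` otherwise. -/
theorem IsLoop.exchange_eq (hγ : IsLoop γ ℓ) (hL : IsSecantLog γ ℓ L B) {C : Set ℂ}
    (hC : C.Finite) {T : Set ℝ} (hT : ∀ t ∈ T, ∃ a b h, IsArc γ a b h ∧ t ∈ Ioo a b)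
    (hCT : range γ \ C ⊆ γ '' T) :
    (B = Real.pi ∧ LiesOnLeft (boundedRegion (range γ)) γ T) ∨
      (B = -Real.pi ∧ ¬ LiesOnLeft (boundedRegion (range γ)) γ T) := by
  obtain ⟨t, htT, a, b, h, ha, ht, hl | hr⟩ := hγ.exists_side_unbounded hC hT hCT
  · right
    refine ⟨?_, fun hleft ↦ ?_⟩
    · obtain ⟨ε, h1, h2⟩ := (hl.and (ha.eventually_hasWindingAngle_left hγ hL ht)).exists
      have := h2.unique hγ.pos (hγ.hasWindingAngle_of_not_isBounded h1.1 h1.2)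
      linarith
    · have := hleft t htT
      rw [(ha.hasDerivAt ht).deriv] at this
      obtain ⟨ε, h1, h2⟩ := (hl.and this).exists
      exact h1.2 h2.2
  · left
    have hB : B = Real.pi := by
      obtain ⟨ε, h1, h2⟩ := (hr.and (ha.eventually_hasWindingAngle_right hγ hL ht)).exists
      have := h2.unique hγ.pos (hγ.hasWindingAngle_of_not_isBounded h1.1 h1.2)
      linarith
    -- Once `B = π` is known from one point, the angle on the left is `2π ≠ 0` at every smooth
    -- point.
    refine ⟨hB, fun t' ht'T ↦ ?_⟩
    obtain ⟨a', b', h', ha', ht'⟩ := hT t' ht'T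
    rw [(ha'.hasDerivAt ht').deriv]
    filter_upwards [ha'.eventually_hasWindingAngle_left hγ hL ht'] with ε hε
    exact hγ.mem_boundedRegion (by rw [hB]; linarith [Real.pi_pos]) hε

/-! ### Reduction of the two claims to loops -/

/-- Parameters with equal values agree modulo `ℓ`, and no integer multiple of `ℓ` lies strictly
between `0` and `ℓ`. -/
theorem isLoop_of_injOn (hℓ : 0 < ℓ) (hp : Function.Periodic γ ℓ) (hc : Continuous γ) {a : ℝ}
    (hinj : InjOn γ (Ico a (a + ℓ))) : IsLoop γ ℓ := by
  refine ⟨hℓ, hp, hc, fun s t h1 h2 h3 ↦ ?_⟩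
  have e : ∀ t, γ (toIcoMod hℓ a t) = γ t := fun t ↦ hp.sub_zsmul_eq (toIcoDiv hℓ a t)
  have h4 : toIcoMod hℓ a s = toIcoMod hℓ a t :=
    hinj (toIcoMod_mem_Ico hℓ a s) (toIcoMod_mem_Ico hℓ a t) (by rw [e, e, h3])
  have h5 := toIcoMod_add_toIcoDiv_zsmul hℓ a s
  have h6 := toIcoMod_add_toIcoDiv_zsmul hℓ a t
  rw [zsmul_eq_mul] at h5 h6
  have h7 : t - s = ((toIcoDiv hℓ a t - toIcoDiv hℓ a s : ℤ) : ℝ) * ℓ := by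
    push_cast
    linarith
  have h8 : 0 < ((toIcoDiv hℓ a t - toIcoDiv hℓ a s : ℤ) : ℝ) :=
    pos_of_mul_pos_left (by linarith) hℓ.le
  have h9 : ((toIcoDiv hℓ a t - toIcoDiv hℓ a s : ℤ) : ℝ) < 1 := by
    by_contra! hcon
    nlinarith
  norm_cast at h8 h9
  omega

/-- A curve on `[a, a + ℓ]` with equal end points has a continuous periodic extension. -/
theorem exists_periodic_extension (hℓ : 0 < ℓ) {a : ℝ} (hc : ContinuousOn γ (Icc a (a + ℓ)))
    (hcl : γ a = γ (a + ℓ)) :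
    ∃ Γ : ℝ → ℂ, Function.Periodic Γ ℓ ∧ Continuous Γ ∧ EqOn Γ γ (Icc a (a + ℓ)) := by
  have : Fact (0 < ℓ) := ⟨hℓ⟩
  have hper : Function.Periodic (fun t : ℝ ↦ AddCircle.liftIco ℓ a γ t) ℓ := fun t ↦ by
    simp
  refine ⟨fun t ↦ AddCircle.liftIco ℓ a γ t, hper,
    (AddCircle.liftIco_continuous hcl hc).comp (AddCircle.continuous_mk' ℓ), fun t ht ↦ ?_⟩
  rcases ht.2.eq_or_lt with h | h
  · subst h
    rw [hper a, ← hcl]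
    exact AddCircle.liftIco_coe_apply ⟨le_rfl, by linarith⟩
  · exact AddCircle.liftIco_coe_apply ⟨ht.1, h⟩

theorem IsArc.congr {γ' : ℝ → ℂ} {a b : ℝ} {h : ℝ × ℝ → ℂ} (ha : IsArc γ a b h)
    (he : EqOn γ' γ (Icc a b)) : IsArc γ' a b h :=
  ⟨ha.lt, ha.continuous, fun s hs t ht ↦ by rw [he hs, he ht, ha.secant s hs t ht], ha.ne⟩

theorem range_eq_image_Icc (hℓ : 0 < ℓ) (hp : Function.Periodic γ ℓ) (a : ℝ) :
    range γ = γ '' Icc a (a + ℓ) :=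
  ((image_subset_range _ _).antisymm (by rw [← hp.image_Icc hℓ a])).symm

theorem exists_mem_arcDomain {n : ℕ} (hn : 0 < n) {τ : Fin (n + 1) → ℝ} (hτ : Monotone τ)
    {t : ℝ} (h0 : τ 0 ≤ t)
    (h1 : t ≤ τ (Fin.last n)) : ∃ i, t ∈ arcDomain τ i := by
  obtain ⟨m, rfl⟩ : ∃ m, n = m + 1 := ⟨n - 1, by omega⟩
  have key : ∀ k, t ≤ τ k → t = τ 0 ∨ ∃ i, t ∈ arcDomain τ i := by
    intro k
    induction k using Fin.induction with
    | zero => exact fun h ↦ Or.inl (le_antisymm h h0)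
    | succ i ih =>
      intro h
      rcases le_total t (τ i.castSucc) with h2 | h2
      · exact ih h2
      · exact Or.inr ⟨i, h2, h⟩
  rcases key _ h1 with rfl | h
  · exact ⟨0, le_rfl, hτ (Fin.zero_le _)⟩
  · exact h

/-- A closed simple piecewise smooth regular curve without cusps has total signed curvature `2 * π`
if the bounded region lies on its left, and `-2 * π` otherwise. -/
theorem piecewise_eq {n : ℕ} {τ : Fin (n + 1) → ℝ}
    (hγ : IsClosedSimplePiecewiseSmoothRegular γ τ) (hdef : TotalSignedCurvatureDefined γ τ) :
    (piecewiseTotalSignedCurvature γ τ = 2 * Real.pi ∧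
      LiesOnLeft (boundedRegion (γ '' Icc (τ 0) (τ (Fin.last n)))) γ
        (⋃ i : Fin n, Ioo (τ i.castSucc) (τ i.succ))) ∨
    (piecewiseTotalSignedCurvature γ τ = -(2 * Real.pi) ∧
      ¬ LiesOnLeft (boundedRegion (γ '' Icc (τ 0) (τ (Fin.last n)))) γ
        (⋃ i : Fin n, Ioo (τ i.castSucc) (τ i.succ))) := by
  have hn := hγ.pos
  have hmono := hγ.strictMono.monotone
  set ℓ := τ (Fin.last n) - τ 0 with hℓdef
  have hℓ : 0 < ℓ := sub_pos.2 (hγ.strictMono (Fin.pos_iff_ne_zero.2 (by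
    simp [Fin.ext_iff]; omega)))
  have hlast : τ (Fin.last n) = τ 0 + ℓ := by rw [hℓdef]; ring
  have hlt : ∀ i : Fin n, τ i.castSucc < τ i.succ := fun i ↦ hγ.strictMono i.castSucc_lt_succ
  have hsub : ∀ i, arcDomain τ i ⊆ Icc (τ 0) (τ 0 + ℓ) := fun i ↦
    hlast ▸ Icc_subset_Icc (hmono (Fin.zero_le _)) (hmono (Fin.le_last _))
  have hcover : Icc (τ 0) (τ 0 + ℓ) ⊆ ⋃ i, arcDomain τ i := fun t ht ↦
    mem_iUnion.2 (exists_mem_arcDomain hn hmono ht.1 (hlast ▸ ht.2))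
  have hcont : ContinuousOn γ (Icc (τ 0) (τ 0 + ℓ)) :=
    (LocallyFinite.continuousOn_iUnion (locallyFinite_of_finite _) (fun i ↦ isClosed_Icc)
      fun i ↦ (hγ.smooth i).continuousOn).mono hcover
  have hclosed : γ (τ 0) = γ (τ 0 + ℓ) := hlast ▸ hγ.closed
  -- Outside `[τ 0, τ n]` the values of `γ` are arbitrary, so the loop is a periodic extension of
  -- the restriction.
  obtain ⟨Γ, hper, hΓc, heq⟩ := exists_periodic_extension hℓ hcont hclosed
  have hinj : InjOn Γ (Ico (τ 0) (τ 0 + ℓ)) :=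
    (hlast ▸ hγ.simple).congr (heq.mono Ico_subset_Icc_self).symm
  have hloop : IsLoop Γ ℓ := isLoop_of_injOn hℓ hper hΓc hinj
  obtain ⟨L, B, hL⟩ := hloop.exists_isSecantLog
  have harc := fun i ↦ exists_isArc (hlt i) ((hγ.smooth i).of_le (by exact_mod_cast le_top))
    (hγ.regular i)
  choose h ha hh using harc
  have hA : ∀ i, IsArc Γ (τ i.castSucc) (τ i.succ) (h i) := fun i ↦
    (ha i).congr (heq.mono (hsub i))
  choose Q hQ using fun i ↦ (hA i).exists_isArcLog hloop hL
  have hθ : ∀ i, externalAngle γ τ i = Complex.arg (h (finRotate n i)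
      (τ (finRotate n i).castSucc, τ (finRotate n i).castSucc) / h i (τ i.succ, τ i.succ)) := by
    intro i
    rw [hh i _ (right_mem_Icc.2 (hlt i).le), hh _ _ (left_mem_Icc.2 (hlt _).le)]
    rfl
  have hΨ : piecewiseTotalSignedCurvature γ τ = 2 * B := by
    rw [← sum_arcLog_eq hloop hL hn hlast hA hQ hθ hdef, piecewiseTotalSignedCurvature]
    congr 1
    refine Finset.sum_congr rfl fun i _ ↦ ?_
    exact (hQ i).curvatureIntegral_eq hℓ (hlt i)
      ((hγ.smooth i).of_le (WithTop.coe_le_coe.2 (le_top : (2 : ℕ∞) ≤ ⊤))) (hh i)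
  set T := ⋃ i : Fin n, Ioo (τ i.castSucc) (τ i.succ) with hTdef
  have hT : ∀ t ∈ T, ∃ a b h, IsArc Γ a b h ∧ t ∈ Ioo a b := fun t ht ↦ by
    obtain ⟨i, hi⟩ := mem_iUnion.1 ht
    exact ⟨_, _, _, hA i, hi⟩
  -- The finite exceptional set consists of the joints.
  have hCT : range Γ \ range (fun i ↦ γ (τ i)) ⊆ Γ '' T := by
    rintro q ⟨hq, hqC⟩
    rw [range_eq_image_Icc hℓ hper (τ 0)] at hq
    obtain ⟨t, ht, rfl⟩ := hq
    obtain ⟨i, hi⟩ := mem_iUnion.1 (hcover ht)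
    rw [heq ht] at hqC
    refine mem_image_of_mem _ (mem_iUnion.2 ⟨i, lt_of_le_of_ne hi.1 ?_, lt_of_le_of_ne hi.2 ?_⟩)
    · rintro rfl
      exact hqC ⟨_, rfl⟩
    · rintro rfl
      exact hqC ⟨_, rfl⟩
  have hrange : γ '' Icc (τ 0) (τ (Fin.last n)) = range Γ := by
    rw [range_eq_image_Icc hℓ hper (τ 0), hlast, heq.image_eq]
  have hleft : LiesOnLeft (boundedRegion (range Γ)) Γ T ↔ LiesOnLeft (boundedRegion (range Γ)) γ T := by
    refine forall₂_congr fun t ht ↦ ?_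
    obtain ⟨i, hi⟩ := mem_iUnion.1 ht
    have hnhds : Γ =ᶠ[𝓝 t] γ := (heq.mono (hsub i)).eventuallyEq_of_mem (Icc_mem_nhds hi.1 hi.2)
    rw [hnhds.deriv_eq, hnhds.eq_of_nhds]
  rw [hrange, ← hleft, hΨ]
  rcases hloop.exchange_eq hL (finite_range _) hT hCT with ⟨hB, h⟩ | ⟨hB, h⟩
  · exact Or.inl ⟨by rw [hB], h⟩
  · exact Or.inr ⟨by rw [hB]; ring, h⟩

theorem velocity_univ_eq {D : Set ℝ} (hγ : Differentiable ℝ γ) (hD : UniqueDiffOn ℝ D) {t : ℝ}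
    (ht : t ∈ D) : velocity γ univ t = velocity γ D t := by
  rw [velocity, velocity, derivWithin_univ, (hγ t).derivWithin (hD t ht)]

/-- One-sided and two-sided derivatives can disagree only at the end points, which do not affect the
integral. -/
theorem curvatureIntegral_univ_eq (hγ : Differentiable ℝ γ) {a b : ℝ} (hab : a < b) :
    curvatureIntegral γ univ a b = curvatureIntegral γ (Icc a b) a b := by
  refine intervalIntegral.integral_congr_Ioo_of_le hab.le fun t ht ↦ ?_
  have hU := uniqueDiffOn_Icc hab
  have hn : Icc a b ∈ 𝓝 t := Icc_mem_nhds ht.1 ht.2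
  have hv : ∀ s ∈ Icc a b, velocity γ univ s = velocity γ (Icc a b) s := fun s hs ↦
    velocity_univ_eq hγ hU hs
  have ht' := Ioo_subset_Icc_self ht
  have hT : EqOn (unitTangent γ univ) (unitTangent γ (Icc a b)) (Icc a b) := fun s hs ↦ by
    rw [unitTangent, unitTangent, hv s hs]
  have hd : derivWithin (unitTangent γ univ) univ t
      = derivWithin (unitTangent γ (Icc a b)) (Icc a b) t := by
    rw [derivWithin_univ, derivWithin_of_mem_nhds hn, (hT.eventuallyEq_of_mem hn).deriv_eq]
  simp only [signedCurvature, unitNormal, hd, hT ht', hv t ht']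

/-- A closed simple smooth regular curve has total signed curvature `2 * π` if the bounded region
lies on its left, and `-2 * π` otherwise. -/
theorem smooth_eq (hγ : IsClosedSimpleSmoothRegular γ ℓ) :
    (totalSignedCurvature γ ℓ = 2 * Real.pi ∧ LiesOnLeft (boundedRegion (range γ)) γ univ) ∨
    (totalSignedCurvature γ ℓ = -(2 * Real.pi) ∧
      ¬ LiesOnLeft (boundedRegion (range γ)) γ univ) := by
  have hℓ := hγ.period_pos
  have hloop : IsLoop γ ℓ := isLoop_of_injOn (a := 0) hℓ hγ.periodic hγ.smooth.continuous
    (by rw [zero_add]; exact hγ.simple)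
  obtain ⟨L, B, hL⟩ := hloop.exists_isSecantLog
  have hdiff : Differentiable ℝ γ := hγ.smooth.differentiable (by simp)
  have harc : ∀ {a b : ℝ}, a < b →
      ∃ h, IsArc γ a b h ∧ ∀ t ∈ Icc a b, h (t, t) = velocity γ (Icc a b) t := fun hab ↦
    exists_isArc hab (hγ.smooth.contDiffOn.of_le (by exact_mod_cast le_top)) fun t ht ↦ by
      rw [← velocity_univ_eq hdiff (uniqueDiffOn_Icc hab) ht]
      exact hγ.regular t
  have hΨ : totalSignedCurvature γ ℓ = 2 * B := by
    obtain ⟨h, ha, hh⟩ := harc hℓ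
    obtain ⟨Q, hQ⟩ := ha.exists_isArcLog hloop hL
    have hv : h (0, 0) = h (ℓ, ℓ) := by
      have hU := uniqueDiffOn_Icc hℓ
      have h0 : (0 : ℝ) ∈ Icc 0 ℓ := left_mem_Icc.2 hℓ.le
      have h1 : ℓ ∈ Icc 0 ℓ := right_mem_Icc.2 hℓ.le
      rw [hh 0 h0, hh ℓ h1, ← velocity_univ_eq hdiff hU h0, ← velocity_univ_eq hdiff hU h1,
        velocity, velocity, derivWithin_univ]
      rw [← zero_add ℓ, ← deriv_comp_add_const]
      exact congrArg (deriv · 0) (funext hγ.periodic).symm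
    have hθ : Complex.arg (h (0, 0) / h (ℓ, ℓ)) = 0 := by
      rw [hv, div_self (ha.ne ℓ (right_mem_Icc.2 hℓ.le)), Complex.arg_one]
    -- The period is a single arc whose only joint has external angle `0`, since the velocity is
    -- periodic.
    have := sum_arcLog_eq hloop hL one_pos (τ := ![0, ℓ]) (by simp) (h := fun _ ↦ h)
      (Q := fun _ ↦ Q) (by simpa using ha) (by simpa using hQ) (θ := fun _ ↦ 0)
      (by simpa using hθ.symm) (fun _ ↦ Real.pi_ne_zero.symm)
    simp at this
    rw [totalSignedCurvature, curvatureIntegral_univ_eq hdiff hℓ, ← this]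
    exact hQ.curvatureIntegral_eq hℓ hℓ
      (hγ.smooth.contDiffOn.of_le (WithTop.coe_le_coe.2 (le_top : (2 : ℕ∞) ≤ ⊤))) hh
  -- Every point is interior to some arc, so there are no exceptional points; such an arc may be
  -- longer than a period.
  have hT : ∀ t ∈ (univ : Set ℝ), ∃ a b h, IsArc γ a b h ∧ t ∈ Ioo a b := fun t _ ↦ by
    obtain ⟨h, ha, -⟩ := harc (show t - 1 < t + 1 by linarith)
    exact ⟨_, _, h, ha, by linarith, by linarith⟩
  rw [hΨ]
  rcases hloop.exchange_eq hL finite_empty hT (by simp) with ⟨hB, h⟩ | ⟨hB, h⟩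
  · exact Or.inl ⟨by rw [hB], h⟩
  · exact Or.inr ⟨by rw [hB]; ring, h⟩

theorem orientation_cases {Ψ : ℝ} {P : Prop}
    (h : (Ψ = 2 * Real.pi ∧ P) ∨ (Ψ = -(2 * Real.pi) ∧ ¬ P)) :
    (Ψ = 2 * Real.pi ∨ Ψ = -(2 * Real.pi)) ∧ (P → Ψ = 2 * Real.pi) ∧
      (¬ P → Ψ = -(2 * Real.pi)) := by
  tauto

end PlaneCurve

theorem mainTheorem10 :
    (∀ (γ : ℝ → ℂ) (ℓ : ℝ), PlaneCurve.IsClosedSimpleSmoothRegular γ ℓ →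
      (PlaneCurve.totalSignedCurvature γ ℓ = 2 * Real.pi ∨
        PlaneCurve.totalSignedCurvature γ ℓ = -(2 * Real.pi)) ∧
      (PlaneCurve.LiesOnLeft (PlaneCurve.boundedRegion (Set.range γ)) γ Set.univ →
        PlaneCurve.totalSignedCurvature γ ℓ = 2 * Real.pi) ∧
      (¬ PlaneCurve.LiesOnLeft (PlaneCurve.boundedRegion (Set.range γ)) γ Set.univ →
        PlaneCurve.totalSignedCurvature γ ℓ = -(2 * Real.pi))) ∧
    (∀ (n : ℕ) (γ : ℝ → ℂ) (τ : Fin (n + 1) → ℝ),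
      PlaneCurve.IsClosedSimplePiecewiseSmoothRegular γ τ →
      PlaneCurve.TotalSignedCurvatureDefined γ τ →
      (PlaneCurve.piecewiseTotalSignedCurvature γ τ = 2 * Real.pi ∨
        PlaneCurve.piecewiseTotalSignedCurvature γ τ = -(2 * Real.pi)) ∧
      (PlaneCurve.LiesOnLeft
          (PlaneCurve.boundedRegion (γ '' Set.Icc (τ 0) (τ (Fin.last n)))) γ
          (⋃ i : Fin n, Set.Ioo (τ i.castSucc) (τ i.succ)) →
        PlaneCurve.piecewiseTotalSignedCurvature γ τ = 2 * Real.pi) ∧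
      (¬ PlaneCurve.LiesOnLeft
          (PlaneCurve.boundedRegion (γ '' Set.Icc (τ 0) (τ (Fin.last n)))) γ
          (⋃ i : Fin n, Set.Ioo (τ i.castSucc) (τ i.succ)) →
        PlaneCurve.piecewiseTotalSignedCurvature γ τ = -(2 * Real.pi))) :=
  ⟨fun _ _ hγ ↦ PlaneCurve.orientation_cases (PlaneCurve.smooth_eq hγ),
    fun _ _ _ hγ hdef ↦ PlaneCurve.orientation_cases (PlaneCurve.piecewise_eq hγ hdef)⟩
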